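/- Let $n\ge 1$, let $\mathcal K(\mathbb R^n)$ be the set of convex bodies (nonempty compact convex subsets) of $\mathbb R^n$ with the Hausdorff metric, and let $M(\mathbb R^n)$ be the space of complex Borel measures on $\mathbb R^n$. A translation invariant curvature measure is a map $\Phi\colon\mathcal K(\mathbb R^n)\to M(\mathbb R^n)$ with the following properties: (a) if $K\cap U=L\cap U$ for an open set $U$, then $\Phi(K,\beta)=\Phi(L,\beta)$ for every Borel set $\beta\subset U$; (b) $\Phi(K+x,\beta+x)=\Phi(K,\beta)$ for all $K$, all Borel sets $\beta$ and all $x\in\mathbb R^n$; (c) if $K_j\to K$, then $\Phi(K_j)\to\Phi(K)$ weakly, that is, when tested against bounded continuous functions. Let $\operatorname{Curv}_{n-1}(\mathbb R^n)$ be the set of those $\Phi$ which are homogeneous of degree $n-1$, i.e. $\Phi(tK,t\beta)=t^{n-1}\Phi(K,\beta)$ for all $K$, all Borel sets $\beta$ and all $t>0$. Let $\Theta_0(K,\cdot),\dots,\Theta_{n-1}(K,\cdot)$ be the support measures of a convex body $K$, i.e. the unique finite Borel measures on $\mathbb R^n\times S^{n-1}$ such that, for every $\varepsilon>0$ and every Borel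 set $\eta\subset\mathbb R^n\times S^{n-1}$, $$\operatorname{vol}\{x+su:\ (x,u)\in\eta,\ x\in K,\ u \text{ is an outer unit normal of } K \text{ at } x,\ 0<s\le\varepsilon\}=\frac1n\sum_{i=0}^{n-1}\varepsilon^{\,n-i}\binom ni\,\Theta_i(K,\eta),$$ and let $\pi\colon\mathbb R^n\times S^{n-1}\to\mathbb R^n$ be the projection. **Theorem.** For every $\Phi\in\operatorname{Curv}_{n-1}(\mathbb R^n)$ there exists a unique continuous function $f\colon S^{n-1}\to\mathbb C$ such that $$\Phi(K,\beta)=\int_{\pi^{-1}(\beta)}f(u)\,d\Theta_{n-1}(K,(x,u))$$ for every convex body $K\subset\mathbb R^n$ and every Borel set $\beta\subset\mathbb R^n$. -/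

import Mathlib

open MeasureTheory Filter Topology
open scoped Pointwise ENNReal RealInnerProductSpace BoundedContinuousFunction

namespace CurvatureMeasures

/-- Euclidean space `ℝⁿ`. -/
abbrev E (n : ℕ) : Type := EuclideanSpace ℝ (Fin n)

/-- The unit sphere `S^{n-1}` of `ℝⁿ`. -/
abbrev Sph (n : ℕ) : Type := Metric.sphere (0 : E n) 1

/-- The translate `K + x` of a convex body. -/
def translate {n : ℕ} (K : ConvexBody (E n)) (x : E n) : ConvexBody (E n) where
  carrier := (fun y => y + x) '' (K : Set (E n))
  convex' := by
    simpa [Set.add_singleton] using K.convex.add (convex_singleton x)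
  isCompact' := K.isCompact.image (continuous_id.add continuous_const)
  nonempty' := K.nonempty.image _

/-- Translation invariant curvature measures on `ℝⁿ`: maps from convex bodies (nonempty compact
convex sets, with the Hausdorff metric) to complex Borel measures which are local, translation
invariant and continuous with respect to weak convergence of measures. -/
structure IsCurvatureMeasure {n : ℕ} (Φ : ConvexBody (E n) → ComplexMeasure (E n)) : Prop where
  locality : ∀ (K L : ConvexBody (E n)) (U : Set (E n)), IsOpen U →
    (K : Set (E n)) ∩ U = (L : Set (E n)) ∩ U →
    ∀ β : Set (E n), MeasurableSet β → β ⊆ U → Φ K β = Φ L β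
  translation_invariance : ∀ (K : ConvexBody (E n)) (β : Set (E n)), MeasurableSet β →
    ∀ x : E n, Φ (translate K x) ((fun y => y + x) '' β) = Φ K β
  continuity : ∀ (K : ℕ → ConvexBody (E n)) (K₀ : ConvexBody (E n)),
    Tendsto K atTop (𝓝 K₀) →
    ∀ g : E n →ᵇ ℝ, Tendsto (fun j => ∫ᵛ x, g x ∂•(Φ (K j))) atTop (𝓝 (∫ᵛ x, g x ∂•(Φ K₀)))

/-- The set `Curv_α(ℝⁿ)` of translation invariant curvature measures that are homogeneous of
degree `α`. -/
def Curv (n : ℕ) (α : ℝ) : Set (ConvexBody (E n) → ComplexMeasure (E n)) :=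
  {Φ | IsCurvatureMeasure Φ ∧
    ∀ (K : ConvexBody (E n)) (β : Set (E n)), MeasurableSet β →
      ∀ t : ℝ, 0 < t → Φ (t • K) (t • β) = ((t ^ α : ℝ) : ℂ) * Φ K β}

/-- The set of pairs `(x, u)` such that `x ∈ K` and `u` is an outer unit normal of `K` at `x`. -/
def normalCycle {n : ℕ} (K : ConvexBody (E n)) : Set (E n × Sph n) :=
  {p | p.1 ∈ K ∧ ∀ y ∈ K, ⟪(p.2 : E n), y - p.1⟫ ≤ 0}

/-- The local parallel set `M_ε(K, η)`: the points `y ∉ K` at distance at most `ε` from `K` for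
which the pair (nearest point `x` of `K`, direction from `x` to `y`) belongs to `η`. -/
def localParallelSet {n : ℕ} (K : ConvexBody (E n)) (ε : ℝ) (η : Set (E n × Sph n)) :
    Set (E n) :=
  {y | ∃ p ∈ normalCycle K ∩ η, ∃ s ∈ Set.Ioc (0 : ℝ) ε, y = p.1 + s • (p.2 : E n)}

/-- The local Steiner formula
`vol (M_ε(K, η)) = (1 / n) ∑_{i=0}^{n-1} ε^{n-i} (n choose i) Θ_i(η)`,
for all `ε > 0` and all Borel sets `η ⊆ ℝⁿ × S^{n-1}`. -/
structure SatisfiesLocalSteiner {n : ℕ} (K : ConvexBody (E n))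
    (Θ : Fin n → Measure (E n × Sph n)) : Prop where
  finite : ∀ i, IsFiniteMeasure (Θ i)
  steiner : ∀ ε : ℝ, 0 < ε → ∀ η : Set (E n × Sph n), MeasurableSet η →
    (n : ℝ≥0∞) * volume (localParallelSet K ε η)
      = ∑ i : Fin n, (n.choose i : ℝ≥0∞) * ENNReal.ofReal ε ^ (n - (i : ℕ)) * Θ i η

/-- At most one family of measures satisfies the local Steiner formula. -/
theorem SatisfiesLocalSteiner.unique {n : ℕ} {K : ConvexBody (E n)}
    {Θ Θ' : Fin n → Measure (E n × Sph n)}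
    (h : SatisfiesLocalSteiner K Θ) (h' : SatisfiesLocalSteiner K Θ') : Θ = Θ' := by
  funext i
  ext η hη
  have key : ∀ {Ψ : Fin n → Measure (E n × Sph n)}, SatisfiesLocalSteiner K Ψ →
      ∀ ε : ℝ, 0 < ε →
      Polynomial.eval ε (∑ j : Fin n, Polynomial.monomial (n - (j : ℕ))
        ((n.choose j : ℝ) * (Ψ j η).toReal))
      = ((n : ℝ≥0∞) * volume (localParallelSet K ε η)).toReal := by
    intro Ψ hΨ ε hε
    have := hΨ.finite
    rw [hΨ.steiner ε hε η hη, ENNReal.toReal_sum, Polynomial.eval_finsetSum]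
    · refine Finset.sum_congr rfl fun j _ => ?_
      simp [ENNReal.toReal_mul, ENNReal.toReal_ofReal hε.le]
      ring
    · intro j _
      exact ENNReal.mul_ne_top (ENNReal.mul_ne_top (by simp) (by simp)) (measure_ne_top _ _)
  have hp := Polynomial.eq_of_infinite_eval_eq _ _
    ((Set.Ioi_infinite (0 : ℝ)).mono fun ε (hε : 0 < ε) => (key h ε hε).trans (key h' ε hε).symm)
  have hc := congrArg (fun p => Polynomial.coeff p (n - (i : ℕ))) hp
  simp only [Polynomial.finsetSum_coeff, Polynomial.coeff_monomial] at hc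
  have hij : ∀ j : Fin n, (n - (j : ℕ) = n - (i : ℕ)) ↔ j = i := by
    intro j
    rw [Fin.ext_iff]
    omega
  simp only [hij, Finset.sum_ite_eq', Finset.mem_univ, if_true] at hc
  have hne : (n.choose i : ℝ) ≠ 0 := by
    exact_mod_cast (Nat.choose_pos i.2.le).ne'
  have := h.finite
  have := h'.finite
  exact (ENNReal.toReal_eq_toReal_iff' (measure_ne_top _ _) (measure_ne_top _ _)).1
    (mul_left_cancel₀ hne hc)

open Classical in
/-- The support measures `Θ_0(K, ·), …, Θ_{n-1}(K, ·)` of a convex body: the unique finite Borel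
measures on `ℝⁿ × S^{n-1}` that satisfy the local Steiner formula. -/
noncomputable def supportMeasure {n : ℕ} (K : ConvexBody (E n)) (i : Fin n) :
    Measure (E n × Sph n) :=
  if h : ∃ Θ, SatisfiesLocalSteiner K Θ then h.choose i else 0

/-- The support measures agree with every family satisfying the local Steiner formula. -/
theorem SatisfiesLocalSteiner.supportMeasure_eq {n : ℕ} {K : ConvexBody (E n)}
    {Θ : Fin n → Measure (E n × Sph n)} (h : SatisfiesLocalSteiner K Θ) :
    supportMeasure K = Θ := by
  have hex : ∃ Θ, SatisfiesLocalSteiner K Θ := ⟨Θ, h⟩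
  funext i
  rw [supportMeasure, dif_pos hex, hex.choose_spec.unique h]

end CurvatureMeasures

/-!
Every `Φ` in `Curv n (n - 1)` has a density against the support measure `Θ_{n-1}`. The density is
read off from half balls, and rigidity of homogeneous local functionals does the rest.

**Support measures.** The metric projection `proj K` is firmly nonexpansive and is a gradient, so
its derivative is symmetric with eigenvalues in `[0, 1]`. The maps `radial K t`, which dilate the
normal rays of `K`, are Lipschitz bijections whose Jacobian is therefore a polynomial in `t` with
nonnegative coefficients. The area formula turns the volumes of the local parallel sets into
polynomials whose coefficients are measures, which proves the local Steiner formula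
(`satisfiesLocalSteiner_supportMeasure`). Locality and the behaviour under similarities follow from
uniqueness, and weak continuity of `Θ_{n-1}` from convergence of the projections
(`tendsto_integral_supportMeasure`). Hence a continuous density `f` defines an element
`curvatureOfDensity f` of `Curv n (n - 1)`.

**Rigidity.** Let `Δ ∈ Curv n (n - 1)` vanish on the facets of all half balls. Then `Δ` vanishes on
polytopes (`curv_variation_eq_zero_of_polyhedral`): a polytope is the union of its strata, where a
fixed set of constraints is active, and near a point of a stratum it is a translate of a fixed cone,
so that the mass of a ball of radius `r` in the stratum is `r ^ (n - 1)` times a constant. The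
constant is `0` on facets by assumption. On the interior and the exterior the mass vanishes, because a
measure has a finite derivative with respect to the volume almost everywhere, which excludes the
order `r ^ (n - 1)`. On the strata of codimension at least two it vanishes, because `r ^ (n - 1)` is
negligible with respect to the volume of an affine subspace of dimension `n - 2`. Both are
instances of the Besicovitch differentiation theorem (`variation_eq_zero_of_closedBall`,
`variation_eq_zero_of_closedBall_eq`). Polytopes are dense and `Δ` is weakly continuous, so `Δ = 0`
(`curv_eq_zero_of_facet_eq_zero`).

**The density.** On the half ball with outer normal `u`, the facet has positive `Θ_{n-1}`-mass
(`supportMeasure_facet_ne_zero`) and normal `u` throughout. This forces the value of the density at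
`u`, hence uniqueness. The ratio of the two masses of the facet, `density`, is continuous in `u`,
because it is also the ratio of two integrals of a fixed continuous function
(`integral_tent_eq`, by rigidity near the facet). The difference of `Φ` and the curvature measure
with this density vanishes on the facets of half balls, so it is zero.
-/

namespace CurvatureMeasures

/-! ### The metric projection onto a convex body -/

section Projection

variable {n : ℕ}

theorem exists_proj (K : ConvexBody (E n)) (y : E n) :
    ∃ p ∈ K, ∀ x ∈ K, ⟪y - p, x - p⟫ ≤ 0 := by
  obtain ⟨p, hp, h⟩ := exists_norm_eq_iInf_of_complete_convex K.nonempty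
    K.isCompact.isComplete K.convex y
  exact ⟨p, hp, (norm_eq_iInf_iff_real_inner_le_zero K.convex hp).1 h⟩

/-- The metric projection onto `K`: the point of `K` nearest to `y`. -/
noncomputable def proj (K : ConvexBody (E n)) (y : E n) : E n := (exists_proj K y).choose

theorem proj_mem (K : ConvexBody (E n)) (y : E n) : proj K y ∈ K :=
  (exists_proj K y).choose_spec.1

theorem proj_inner_le (K : ConvexBody (E n)) (y : E n) {x : E n} (hx : x ∈ K) :
    ⟪y - proj K y, x - proj K y⟫ ≤ 0 :=
  (exists_proj K y).choose_spec.2 x hx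

theorem proj_eq_of_inner_le {K : ConvexBody (E n)} {y p : E n} (hp : p ∈ K)
    (h : ∀ x ∈ K, ⟪y - p, x - p⟫ ≤ 0) : proj K y = p := by
  have h1 := h _ (proj_mem K y)
  have h2 := proj_inner_le K y hp
  have h3 : ⟪proj K y - p, proj K y - p⟫ ≤ 0 := by
    have : ⟪proj K y - p, proj K y - p⟫
        = ⟪y - p, proj K y - p⟫ + ⟪y - proj K y, p - proj K y⟫ := by
      simp only [inner_sub_left, inner_sub_right]; ring
    linarith
  exact sub_eq_zero.1 (real_inner_self_nonpos.1 h3)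

theorem proj_of_mem {K : ConvexBody (E n)} {y : E n} (hy : y ∈ K) : proj K y = y :=
  proj_eq_of_inner_le hy fun x _ => by simp

/-- The metric projection is firmly nonexpansive. -/
theorem norm_proj_sub_sq_le (K : ConvexBody (E n)) (y z : E n) :
    ‖proj K y - proj K z‖ ^ 2 ≤ ⟪proj K y - proj K z, y - z⟫ := by
  have h1 := proj_inner_le K y (proj_mem K z)
  have h2 := proj_inner_le K z (proj_mem K y)
  rw [← real_inner_self_eq_norm_sq]
  have : ⟪proj K y - proj K z, y - z⟫ - ⟪proj K y - proj K z, proj K y - proj K z⟫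
      = -⟪y - proj K y, proj K z - proj K y⟫ - ⟪z - proj K z, proj K y - proj K z⟫ := by
    simp only [inner_sub_left, inner_sub_right]
    rw [real_inner_comm y (proj K y), real_inner_comm z (proj K y),
      real_inner_comm y (proj K z), real_inner_comm z (proj K z)]
    ring
  linarith

theorem norm_proj_sub_le (K : ConvexBody (E n)) (y z : E n) :
    ‖proj K y - proj K z‖ ≤ ‖y - z‖ := by
  have h := (norm_proj_sub_sq_le K y z).trans (real_inner_le_norm _ _)
  rcases (norm_nonneg (proj K y - proj K z)).eq_or_lt with h0 | h0
  · rw [← h0]; exact norm_nonneg _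
  · rw [pow_two] at h
    exact le_of_mul_le_mul_left h h0

theorem lipschitzWith_proj (K : ConvexBody (E n)) : LipschitzWith 1 (proj K) :=
  LipschitzWith.of_dist_le_mul fun y z => by
    simpa [dist_eq_norm] using norm_proj_sub_le K y z

theorem continuous_proj (K : ConvexBody (E n)) : Continuous (proj K) :=
  (lipschitzWith_proj K).continuous

theorem norm_sub_proj_le (K : ConvexBody (E n)) (y : E n) {x : E n} (hx : x ∈ K) :
    ‖y - proj K y‖ ≤ ‖y - x‖ := by
  have h := proj_inner_le K y hx
  have h2 : ‖y - x‖ ^ 2 = ‖y - proj K y‖ ^ 2 - 2 * ⟪y - proj K y, x - proj K y⟫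
      + ‖x - proj K y‖ ^ 2 := by
    rw [← norm_sub_sq_real]; congr 2; abel
  nlinarith [norm_nonneg (y - proj K y), norm_nonneg (y - x), sq_nonneg ‖x - proj K y‖]

theorem mem_iff_proj_eq {K : ConvexBody (E n)} {y : E n} : y ∈ K ↔ proj K y = y :=
  ⟨proj_of_mem, fun h => h ▸ proj_mem K y⟩

/-- The metric projection is the gradient of the convex function
`y ↦ sup_{x ∈ K} ⟪x, y⟫ - ‖x‖² / 2`, where the supremum is attained at `proj K y`. -/
theorem hasFDerivAt_potential (K : ConvexBody (E n)) (y : E n) :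
    HasFDerivAt (fun z => ⟪z, proj K z⟫ - ‖proj K z‖ ^ 2 / 2) (innerSL ℝ (proj K y)) y := by
  set φ : E n → ℝ := fun z => ⟪z, proj K z⟫ - ‖proj K z‖ ^ 2 / 2 with hφ
  have key : ∀ a b, φ b + ⟪proj K b, a - b⟫ ≤ φ a := by
    intro a b
    have h := norm_sub_proj_le K a (proj_mem K b)
    have h' : ‖a - proj K a‖ ^ 2 ≤ ‖a - proj K b‖ ^ 2 := by gcongr
    rw [norm_sub_sq_real, norm_sub_sq_real] at h'
    simp only [hφ, inner_sub_right]
    rw [real_inner_comm a (proj K b), real_inner_comm b (proj K b)]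
    linarith
  rw [hasFDerivAt_iff_isLittleO]
  refine Asymptotics.IsBigO.trans_isLittleO (g := fun z => ‖z - y‖ ^ 2) ?_ ?_
  · refine Asymptotics.IsBigO.of_bound 1 (Eventually.of_forall fun z => ?_)
    have h1 := key z y
    have h2 := key y z
    have h3 : ⟪proj K z, y - z⟫ = - ⟪proj K y, z - y⟫ - ⟪proj K z - proj K y, z - y⟫ := by
      simp only [inner_sub_left, inner_sub_right]; ring
    have h4 := (real_inner_le_norm (proj K z - proj K y) (z - y)).trans
      (mul_le_mul_of_nonneg_right (norm_proj_sub_le K z y) (norm_nonneg _))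
    rw [innerSL_apply_apply, Real.norm_eq_abs, abs_of_nonneg (by linarith), norm_pow, norm_norm]
    nlinarith
  · exact Asymptotics.isLittleO_pow_sub_sub y one_lt_two |>.congr_left fun z => rfl

/-- The derivative of the metric projection is a Hessian, hence symmetric. -/
theorem inner_fderiv_proj_comm {K : ConvexBody (E n)} {y : E n}
    (h : DifferentiableAt ℝ (proj K) y) (v w : E n) :
    ⟪fderiv ℝ (proj K) y v, w⟫ = ⟪v, fderiv ℝ (proj K) y w⟫ := by
  have h2 : HasFDerivAt (fun z => innerSL ℝ (proj K z))
      ((innerSL ℝ).toContinuousLinearMap.comp (fderiv ℝ (proj K) y)) y :=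
    ((innerSL ℝ).toContinuousLinearMap.hasFDerivAt).comp y h.hasFDerivAt
  have := second_derivative_symmetric (hasFDerivAt_potential K) h2 v w
  simpa [real_inner_comm] using this

/-- Firm nonexpansiveness in infinitesimal form: the eigenvalues of the derivative of the metric
projection lie in `[0, 1]`. -/
theorem norm_fderiv_proj_sq_le (K : ConvexBody (E n)) (y v : E n) :
    ‖fderiv ℝ (proj K) y v‖ ^ 2 ≤ ⟪fderiv ℝ (proj K) y v, v⟫ := by
  by_cases h : DifferentiableAt ℝ (proj K) y
  · have h1 : Tendsto (fun t : ℝ => t⁻¹ • (proj K (y + t • v) - proj K y)) (𝓝[≠] 0)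
        (𝓝 (fderiv ℝ (proj K) y v)) :=
      hasLineDerivAt_iff_tendsto_slope_zero.1 (h.hasFDerivAt.hasLineDerivAt v)
    refine le_of_tendsto_of_tendsto (h1.norm.pow 2) (h1.inner tendsto_const_nhds) ?_
    filter_upwards [self_mem_nhdsWithin] with t (ht : t ≠ 0)
    have h3 := norm_proj_sub_sq_le K (y + t • v) y
    rw [add_sub_cancel_left, inner_smul_right] at h3
    rw [norm_smul, mul_pow, norm_inv, Real.norm_eq_abs, inv_pow, sq_abs, inner_smul_left]
    simp only [conj_trivial]
    have ht2 : 0 < t ^ 2 := by positivity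
    rw [inv_mul_le_iff₀ ht2]
    calc _ ≤ _ := h3
      _ = _ := by field_simp
  · simp [fderiv_zero_of_not_differentiableAt h]

/-- In an eigenbasis of the derivative `A` of the metric projection, whose eigenvalues lie in
`[0, 1]`, the determinant of `t + (1 - t) A` is a product of linear factors with nonnegative
coefficients. -/
theorem exists_det_fderiv_proj (K : ConvexBody (E n)) (y : E n) :
    ∃ μ : Fin n → ℝ, (∀ i, 0 ≤ μ i ∧ μ i ≤ 1) ∧ ∀ t : ℝ,
      (t • ContinuousLinearMap.id ℝ (E n) + (1 - t) • fderiv ℝ (proj K) y).det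
        = ∏ i, (μ i + t * (1 - μ i)) := by
  have hsymm : ((fderiv ℝ (proj K) y : E n →L[ℝ] E n) : E n →ₗ[ℝ] E n).IsSymmetric := by
    intro v w
    by_cases h : DifferentiableAt ℝ (proj K) y
    · exact inner_fderiv_proj_comm h v w
    · simp [fderiv_zero_of_not_differentiableAt h]
  have hn : Module.finrank ℝ (E n) = n := by simp
  set b := hsymm.eigenvectorBasis hn with hb
  have happ : ∀ i, fderiv ℝ (proj K) y (b i) = hsymm.eigenvalues hn i • b i := fun i =>
    hsymm.apply_eigenvectorBasis hn i
  refine ⟨hsymm.eigenvalues hn, fun i => ?_, fun t => ?_⟩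
  · have h := norm_fderiv_proj_sq_le K y (b i)
    rw [happ, norm_smul, inner_smul_left, real_inner_self_eq_norm_sq, b.norm_eq_one] at h
    simp at h
    constructor <;> nlinarith
  · rw [ContinuousLinearMap.det, ← LinearMap.det_toMatrix b.toBasis]
    have : LinearMap.toMatrix b.toBasis b.toBasis
        ((t • ContinuousLinearMap.id ℝ (E n) + (1 - t) • fderiv ℝ (proj K) y : E n →L[ℝ] E n) :
          E n →ₗ[ℝ] E n)
        = Matrix.diagonal fun i => hsymm.eigenvalues hn i + t * (1 - hsymm.eigenvalues hn i) := by
      ext i j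
      rw [LinearMap.toMatrix_apply]
      simp only [OrthonormalBasis.coe_toBasis, OrthonormalBasis.coe_toBasis_repr_apply,
        ContinuousLinearMap.coe_coe, add_apply,
        smul_apply, ContinuousLinearMap.id_apply, happ, smul_smul, ← add_smul]
      rw [map_smul, OrthonormalBasis.repr_self]
      by_cases hij : i = j
      · subst hij; simp; ring
      · simp [hij]
    rw [this, Matrix.det_diagonal]

end Projection

/-! ### The local Steiner formula -/

section Steiner

variable {n : ℕ}

/-- The point on the ray from `proj K y` through `y` whose distance to `proj K y` is multiplied
by `t`. -/
noncomputable def radial (K : ConvexBody (E n)) (t : ℝ) (y : E n) : E n :=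
  proj K y + t • (y - proj K y)

theorem proj_add_smul (K : ConvexBody (E n)) (y : E n) {t : ℝ} (ht : 0 ≤ t) :
    proj K (proj K y + t • (y - proj K y)) = proj K y :=
  proj_eq_of_inner_le (proj_mem K y) fun x hx => by
    rw [add_sub_cancel_left, inner_smul_left]
    exact mul_nonpos_of_nonneg_of_nonpos (by simpa using ht) (proj_inner_le K y hx)

theorem proj_radial (K : ConvexBody (E n)) (y : E n) {t : ℝ} (ht : 0 ≤ t) :
    proj K (radial K t y) = proj K y := proj_add_smul K y ht

theorem radial_sub_proj (K : ConvexBody (E n)) (y : E n) {t : ℝ} (ht : 0 ≤ t) :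
    radial K t y - proj K (radial K t y) = t • (y - proj K y) := by
  rw [proj_radial K y ht, radial, add_sub_cancel_left]

theorem radial_radial (K : ConvexBody (E n)) (y : E n) (s : ℝ) {t : ℝ} (ht : 0 ≤ t) :
    radial K s (radial K t y) = radial K (s * t) y := by
  rw [radial, radial_sub_proj K y ht, proj_radial K y ht, radial, smul_smul]

theorem radial_one (K : ConvexBody (E n)) (y : E n) : radial K 1 y = y := by
  simp [radial]

theorem radial_injective (K : ConvexBody (E n)) {t : ℝ} (ht : 0 < t) :
    Function.Injective (radial K t) :=
  Function.LeftInverse.injective (g := radial K t⁻¹) fun y => by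
    rw [radial_radial K y _ ht.le, inv_mul_cancel₀ ht.ne', radial_one]

theorem radial_mem_iff (K : ConvexBody (E n)) (y : E n) {t : ℝ} (ht : 0 < t) :
    radial K t y ∈ K ↔ y ∈ K := by
  rw [mem_iff_proj_eq, mem_iff_proj_eq, eq_comm, ← sub_eq_zero, radial_sub_proj K y ht.le,
    smul_eq_zero_iff_right ht.ne', sub_eq_zero, eq_comm]

theorem exists_lipschitzWith_radial (K : ConvexBody (E n)) (t : ℝ) :
    ∃ C, LipschitzWith C (radial K t) :=
  ⟨_, (lipschitzWith_proj K).add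
    ((lipschitzWith_smul t).comp (LipschitzWith.id.sub (lipschitzWith_proj K)))⟩

theorem hasFDerivAt_radial {K : ConvexBody (E n)} {y : E n} (t : ℝ)
    (h : DifferentiableAt ℝ (proj K) y) :
    HasFDerivAt (radial K t)
      (t • ContinuousLinearMap.id ℝ (E n) + (1 - t) • fderiv ℝ (proj K) y) y := by
  have h1 := h.hasFDerivAt.add (((hasFDerivAt_id y).sub h.hasFDerivAt).const_smul t)
  exact h1.congr_fderiv (by module)

theorem volume_image_eq_zero_of_lipschitzWith {C : NNReal} {F : E n → E n}
    (hF : LipschitzWith C F) {s : Set (E n)} (hs : volume s = 0) : volume (F '' s) = 0 := by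
  let μ : Measure (E n) := Measure.hausdorffMeasure (Module.finrank ℝ (E n))
  have h1 : μ ≪ (volume : Measure (E n)) := Measure.absolutelyContinuous_isAddHaarMeasure _ _
  have h2 : (volume : Measure (E n)) ≪ μ := Measure.absolutelyContinuous_isAddHaarMeasure _ _
  refine h2 (le_antisymm ((hF.hausdorffMeasure_image_le (by positivity) s).trans ?_) zero_le)
  rw [show Measure.hausdorffMeasure (Module.finrank ℝ (E n) : ℝ) s = 0 from h1 hs, mul_zero]

theorem det_fderiv_radial_nonneg (K : ConvexBody (E n)) (y : E n) {t : ℝ} (ht : 0 ≤ t) :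
    0 ≤ (t • ContinuousLinearMap.id ℝ (E n) + (1 - t) • fderiv ℝ (proj K) y).det := by
  obtain ⟨μ, hμ, h⟩ := exists_det_fderiv_proj K y
  rw [h]
  exact Finset.prod_nonneg fun i _ =>
    add_nonneg (hμ i).1 (mul_nonneg ht (sub_nonneg.2 (hμ i).2))

/-- The area formula for the bijective Lipschitz map `radial K t`, differentiable almost everywhere
by Rademacher's theorem. -/
theorem volume_radial_image (K : ConvexBody (E n)) {t : ℝ} (ht : 0 < t) {s : Set (E n)}
    (hs : MeasurableSet s) :
    volume (radial K t '' s) = ∫⁻ y in s, ENNReal.ofReal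
      (t • ContinuousLinearMap.id ℝ (E n) + (1 - t) • fderiv ℝ (proj K) y).det := by
  set D := {y | DifferentiableAt ℝ (proj K) y}
  have hD : MeasurableSet D := measurableSet_of_differentiableAt ℝ (proj K)
  have hDc : volume Dᶜ = 0 := (lipschitzWith_proj K).ae_differentiableAt
  obtain ⟨C, hC⟩ := exists_lipschitzWith_radial K t
  have h0 : volume (radial K t '' (s \ D)) = 0 :=
    volume_image_eq_zero_of_lipschitzWith hC (measure_mono_null (fun _ h => h.2) hDc)
  have h1 : volume (radial K t '' s) = volume (radial K t '' (s ∩ D)) := by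
    refine le_antisymm ?_ (measure_mono (Set.image_mono Set.inter_subset_left))
    conv_lhs => rw [← Set.inter_union_sdiff s D, Set.image_union]
    exact (measure_union_le _ _).trans (by rw [h0, add_zero])
  have h2 : (s ∩ D : Set (E n)) =ᵐ[volume] s :=
    inter_ae_eq_left_of_ae_eq_univ (ae_eq_univ.2 hDc)
  rw [h1, ← lintegral_abs_det_fderiv_eq_addHaar_image volume (hs.inter hD)
    (fun y hy => (hasFDerivAt_radial t hy.2).hasFDerivWithinAt) (radial_injective K ht).injOn,
    setLIntegral_congr h2]
  simp_rw [abs_of_nonneg (det_fderiv_radial_nonneg K _ ht.le)]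

theorem norm_sub_proj_pos {K : ConvexBody (E n)} {y : E n} (hy : y ∉ K) :
    0 < ‖y - proj K y‖ :=
  norm_pos_iff.2 fun h0 => hy (mem_iff_proj_eq.2 (sub_eq_zero.1 h0).symm)

/-- The points outside `K` at distance at most `ε` from `K`. -/
def shell (K : ConvexBody (E n)) (ε : ℝ) : Set (E n) := {y | y ∉ K ∧ ‖y - proj K y‖ ≤ ε}

theorem measurableSet_shell (K : ConvexBody (E n)) (ε : ℝ) : MeasurableSet (shell K ε) :=
  K.isClosed.measurableSet.compl.inter
    ((continuous_id.sub (continuous_proj K)).norm.measurable measurableSet_Iic)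

theorem proj_add_smul_of_mem_normalCycle {K : ConvexBody (E n)} {p : E n × Sph n}
    (hp : p ∈ normalCycle K) {s : ℝ} (hs : 0 ≤ s) : proj K (p.1 + s • (p.2 : E n)) = p.1 :=
  proj_eq_of_inner_le hp.1 fun x hx => by
    rw [add_sub_cancel_left, inner_smul_left]
    exact mul_nonpos_of_nonneg_of_nonpos (by simpa using hs) (hp.2 x hx)

theorem norm_coe_sph (u : Sph n) : ‖(u : E n)‖ = 1 := by simp

variable [Nonempty (Sph n)]

open Classical in
/-- The unit vector pointing from `proj K y` to `y`, for `y ∉ K` (an arbitrary unit vector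
otherwise). -/
noncomputable def normalDir (K : ConvexBody (E n)) (y : E n) : Sph n :=
  if h : y ∈ K then Classical.arbitrary _ else
    ⟨‖y - proj K y‖⁻¹ • (y - proj K y), by
      have : y - proj K y ≠ 0 := fun h0 => h (mem_iff_proj_eq.2 (sub_eq_zero.1 h0).symm)
      simpa using norm_smul_inv_norm (𝕜 := ℝ) this⟩

theorem coe_normalDir {K : ConvexBody (E n)} {y : E n} (hy : y ∉ K) :
    (normalDir K y : E n) = ‖y - proj K y‖⁻¹ • (y - proj K y) := by
  rw [normalDir, dif_neg hy]

theorem norm_smul_normalDir {K : ConvexBody (E n)} {y : E n} (hy : y ∉ K) :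
    ‖y - proj K y‖ • (normalDir K y : E n) = y - proj K y := by
  rw [coe_normalDir hy, smul_smul, mul_inv_cancel₀ (norm_sub_proj_pos hy).ne', one_smul]

theorem measurable_normalDir (K : ConvexBody (E n)) : Measurable (normalDir K) := by
  classical
  have hK : MeasurableSet (K : Set (E n)) := K.isClosed.measurableSet
  rw [← (MeasurableEmbedding.subtype_coe Metric.isClosed_sphere.measurableSet).measurable_comp_iff]
  have h : (Subtype.val ∘ normalDir K : E n → E n) = fun y => if y ∈ (K : Set (E n)) then
      ((Classical.arbitrary (Sph n) : Sph n) : E n) else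
      ‖y - proj K y‖⁻¹ • (y - proj K y) := by
    funext y
    by_cases hy : y ∈ K
    · simp [normalDir, hy]
    · simp [coe_normalDir hy, hy]
  have hm : Measurable fun y : E n => y - proj K y :=
    measurable_id.sub (continuous_proj K).measurable
  rw [h]
  exact Measurable.ite hK measurable_const (hm.norm.inv.smul hm)

/-- The nearest point in `K` together with the direction pointing away from it. -/
noncomputable def gaussPair (K : ConvexBody (E n)) (y : E n) : E n × Sph n :=
  (proj K y, normalDir K y)

theorem measurable_gaussPair (K : ConvexBody (E n)) : Measurable (gaussPair K) :=
  (continuous_proj K).measurable.prodMk (measurable_normalDir K)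

theorem gaussPair_mem_normalCycle {K : ConvexBody (E n)} {y : E n} (hy : y ∉ K) :
    gaussPair K y ∈ normalCycle K := by
  refine ⟨proj_mem K y, fun x hx => ?_⟩
  simp only [gaussPair, coe_normalDir hy, inner_smul_left]
  exact mul_nonpos_of_nonneg_of_nonpos (by simp) (proj_inner_le K y hx)

theorem localParallelSet_eq (K : ConvexBody (E n)) (ε : ℝ) (η : Set (E n × Sph n)) :
    localParallelSet K ε η = shell K ε ∩ gaussPair K ⁻¹' η := by
  ext y
  constructor
  · rintro ⟨p, ⟨hp, hpη⟩, s, hs, rfl⟩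
    have hproj := proj_add_smul_of_mem_normalCycle hp hs.1.le
    have hnorm : ‖p.1 + s • (p.2 : E n) - proj K (p.1 + s • (p.2 : E n))‖ = s := by
      rw [hproj, add_sub_cancel_left, norm_smul, norm_coe_sph, mul_one, Real.norm_eq_abs,
        abs_of_pos hs.1]
    have hnot : p.1 + s • (p.2 : E n) ∉ K := fun h => by
      rw [proj_of_mem h, sub_self, norm_zero] at hnorm
      exact hs.1.ne hnorm
    refine ⟨⟨hnot, hnorm.trans_le hs.2⟩, ?_⟩
    have : gaussPair K (p.1 + s • (p.2 : E n)) = p := by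
      refine Prod.ext hproj (Subtype.ext ?_)
      simp only [gaussPair]
      rw [coe_normalDir hnot, hnorm, hproj, add_sub_cancel_left, smul_smul,
        inv_mul_cancel₀ hs.1.ne', one_smul]
    rwa [Set.mem_preimage, this]
  · rintro ⟨⟨hy, hd⟩, hη⟩
    exact ⟨_, ⟨gaussPair_mem_normalCycle hy, hη⟩, _, ⟨norm_sub_proj_pos hy, hd⟩, by
      simp only [gaussPair]
      rw [norm_smul_normalDir hy, add_sub_cancel]⟩

theorem gaussPair_radial {K : ConvexBody (E n)} {y : E n} (hy : y ∉ K) {t : ℝ} (ht : 0 < t) :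
    gaussPair K (radial K t y) = gaussPair K y := by
  have hy' : radial K t y ∉ K := (radial_mem_iff K y ht).not.2 hy
  refine Prod.ext (proj_radial K y ht.le) (Subtype.ext ?_)
  simp only [gaussPair]
  rw [coe_normalDir hy', coe_normalDir hy, radial_sub_proj K y ht.le, norm_smul, smul_smul,
    Real.norm_eq_abs, abs_of_pos ht]
  congr 1
  have := (norm_sub_proj_pos hy).ne'
  field_simp

/-- All local parallel sets over `η` are radial images of one of them, so that their volumes are
integrals of Jacobians over a fixed domain. -/
theorem image_radial_localParallelSet (K : ConvexBody (E n)) (ε : ℝ) (η : Set (E n × Sph n))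
    {t : ℝ} (ht : 0 < t) :
    radial K t '' localParallelSet K ε η = localParallelSet K (t * ε) η := by
  have key : ∀ {ε s : ℝ}, 0 < s → ∀ y ∈ localParallelSet K ε η,
      radial K s y ∈ localParallelSet K (s * ε) η := by
    intro ε s hs y hy
    rw [localParallelSet_eq] at hy ⊢
    refine ⟨⟨(radial_mem_iff K y hs).not.2 hy.1.1, ?_⟩, ?_⟩
    · rw [radial_sub_proj K y hs.le, norm_smul, Real.norm_eq_abs, abs_of_pos hs]
      exact mul_le_mul_of_nonneg_left hy.1.2 hs.le
    · rw [Set.mem_preimage, gaussPair_radial hy.1.1 hs]; exact hy.2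
  refine Set.Subset.antisymm (Set.image_subset_iff.2 (key ht)) fun y hy => ?_
  refine ⟨radial K t⁻¹ y, ?_, ?_⟩
  · simpa [ht.ne'] using key (inv_pos.2 ht) y hy
  · rw [radial_radial K y _ (inv_pos.2 ht).le, mul_inv_cancel₀ ht.ne', radial_one]

end Steiner

section Density

variable {n : ℕ}

/-- The `k`-th coefficient of the `j`-th Lagrange basis polynomial for the nodes `0, 1, …, n`. -/
noncomputable def lagrangeCoeff (n k j : ℕ) : ℝ :=
  (Lagrange.basis (Finset.range (n + 1)) (fun i : ℕ => (i : ℝ)) j).coeff k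

theorem coeff_eq_sum_lagrangeCoeff {P : Polynomial ℝ} (hP : P.natDegree ≤ n) (k : ℕ) :
    P.coeff k = ∑ j ∈ Finset.range (n + 1), lagrangeCoeff n k j * P.eval (j : ℝ) := by
  have hdeg : P.degree < (Finset.range (n + 1)).card := by
    rw [Finset.card_range]
    exact Polynomial.degree_le_natDegree.trans_lt (by exact_mod_cast Nat.lt_succ_of_le hP)
  conv_lhs => rw [Lagrange.eq_interpolate (v := fun i : ℕ => (i : ℝ))
    (Nat.cast_injective.injOn) hdeg]
  rw [Lagrange.interpolate_apply, Polynomial.finsetSum_coeff]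
  exact Finset.sum_congr rfl fun j _ => by rw [Polynomial.coeff_C_mul, mul_comm]; rfl

/-- The Jacobian determinant of `radial K t` at `y`. -/
noncomputable def radialJacobian (K : ConvexBody (E n)) (t : ℝ) (y : E n) : ℝ :=
  (t • ContinuousLinearMap.id ℝ (E n) + (1 - t) • fderiv ℝ (proj K) y).det

/-- The coefficient of `t ^ k` in the Jacobian determinant of `radial K t` at `y`. It is written
as a combination of values of the determinant, which makes its measurability plain. -/
noncomputable def steinerDensity (K : ConvexBody (E n)) (k : ℕ) (y : E n) : ℝ :=
  ∑ j ∈ Finset.range (n + 1), lagrangeCoeff n k j * radialJacobian K j y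

theorem measurable_radialJacobian (K : ConvexBody (E n)) (t : ℝ) :
    Measurable (radialJacobian K t) :=
  ContinuousLinearMap.continuous_det.measurable.comp
    (((measurable_fderiv ℝ (proj K)).const_smul (1 - t)).const_add _)

theorem measurable_steinerDensity (K : ConvexBody (E n)) (k : ℕ) :
    Measurable (steinerDensity K k) :=
  Finset.measurable_fun_sum _ fun j _ => (measurable_radialJacobian K j).const_mul _

theorem coeff_prod_linear_nonneg {ι : Type*} (s : Finset ι) (a b : ι → ℝ) (ha : ∀ i, 0 ≤ a i)
    (hb : ∀ i, 0 ≤ b i) (k : ℕ) :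
    0 ≤ (∏ i ∈ s, (Polynomial.C (a i) + Polynomial.C (b i) * Polynomial.X)).coeff k := by
  classical
  induction s using Finset.induction_on generalizing k with
  | empty => rw [Finset.prod_empty, Polynomial.coeff_one]; split_ifs <;> norm_num
  | insert i s hi ih =>
    rw [Finset.prod_insert hi, add_mul, Polynomial.coeff_add, Polynomial.coeff_C_mul, mul_assoc,
      Polynomial.coeff_C_mul]
    refine add_nonneg (mul_nonneg (ha i) (ih k)) (mul_nonneg (hb i) ?_)
    cases k with
    | zero => simp
    | succ k => rw [Polynomial.coeff_X_mul]; exact ih k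

/-- The Jacobian determinant of `radial K t` is a polynomial in `t` of degree at most `n` whose
coefficients, the Steiner densities, are nonnegative. -/
theorem exists_polynomial_radialJacobian (K : ConvexBody (E n)) (y : E n) :
    ∃ P : Polynomial ℝ, P.natDegree ≤ n ∧ (∀ k, P.coeff k = steinerDensity K k y) ∧
      (∀ k, 0 ≤ P.coeff k) ∧ ∀ t, P.eval t = radialJacobian K t y := by
  obtain ⟨μ, hμ, h⟩ := exists_det_fderiv_proj K y
  set P : Polynomial ℝ := ∏ i, (Polynomial.C (μ i) + Polynomial.C (1 - μ i) * Polynomial.X)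
  have heval : ∀ t, P.eval t = radialJacobian K t y := fun t => by
    rw [radialJacobian, h, Polynomial.eval_prod]
    exact Finset.prod_congr rfl fun i _ => by
      simp only [Polynomial.eval_add, Polynomial.eval_C, Polynomial.eval_mul, Polynomial.eval_X]
      ring
  have hdeg : P.natDegree ≤ n := by
    refine (Polynomial.natDegree_prod_le _ _).trans ?_
    refine (Finset.sum_le_card_nsmul _ _ 1 fun i _ => ?_).trans (by simp)
    rw [add_comm]
    exact Polynomial.natDegree_linear_le
  refine ⟨P, hdeg, fun k => ?_, fun k => ?_, heval⟩
  · rw [coeff_eq_sum_lagrangeCoeff hdeg, steinerDensity]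
    simp_rw [heval]
  · exact coeff_prod_linear_nonneg _ _ _ (fun i => (hμ i).1) (fun i => sub_nonneg.2 (hμ i).2) k

theorem steinerDensity_nonneg (K : ConvexBody (E n)) (k : ℕ) (y : E n) :
    0 ≤ steinerDensity K k y := by
  obtain ⟨P, -, h1, h2, -⟩ := exists_polynomial_radialJacobian K y
  exact h1 k ▸ h2 k

theorem radialJacobian_eq_sum (K : ConvexBody (E n)) (y : E n) (t : ℝ) :
    radialJacobian K t y = ∑ k ∈ Finset.range (n + 1), steinerDensity K k y * t ^ k := by
  obtain ⟨P, h0, h1, -, h3⟩ := exists_polynomial_radialJacobian K y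
  rw [← h3, Polynomial.eval_eq_sum_range' (Nat.lt_succ_of_le h0)]
  simp_rw [h1]

theorem steinerDensity_le_one (K : ConvexBody (E n)) {k : ℕ} (hk : k ≤ n) (y : E n) :
    steinerDensity K k y ≤ 1 := by
  have h := radialJacobian_eq_sum K y 1
  have h1 : radialJacobian K 1 y = 1 := by simp [radialJacobian, ContinuousLinearMap.det]
  simp only [one_pow, mul_one] at h
  rw [← h1, h]
  exact Finset.single_le_sum (f := fun k => steinerDensity K k y)
    (fun i _ => steinerDensity_nonneg K i y) (Finset.mem_range.2 (Nat.lt_succ_of_le hk))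

/-- The projection is constant along the normal ray through `y`, so its derivative is singular. -/
theorem steinerDensity_zero {K : ConvexBody (E n)} {y : E n} (hy : y ∉ K) :
    steinerDensity K 0 y = 0 := by
  have h := radialJacobian_eq_sum K y 0
  rw [Finset.sum_range_succ'] at h
  simp only [pow_succ, mul_zero, Finset.sum_const_zero, pow_zero, mul_one, zero_add] at h
  rw [← h, radialJacobian]
  have hker : fderiv ℝ (proj K) y (y - proj K y) = 0 := by
    by_cases hd : DifferentiableAt ℝ (proj K) y
    · have h1 := (hasLineDerivAt_iff_tendsto_slope_zero.1
        (hd.hasFDerivAt.hasLineDerivAt (y - proj K y))).mono_left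
        (nhdsGT_le_nhdsNE 0)
      refine tendsto_nhds_unique h1 (tendsto_const_nhds.congr' ?_)
      filter_upwards [self_mem_nhdsWithin] with t (ht : 0 < t)
      have : y + t • (y - proj K y) = radial K (1 + t) y := by rw [radial]; module
      rw [this, proj_radial K y (by positivity), sub_self, smul_zero]
    · simp [fderiv_zero_of_not_differentiableAt hd]
  refine LinearMap.det_eq_zero_iff_ker_ne_bot.2 fun hbot => ?_
  have hv : y - proj K y ∈ LinearMap.ker
      (((0 : ℝ) • ContinuousLinearMap.id ℝ (E n) + (1 - 0 : ℝ) • fderiv ℝ (proj K) y :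
        E n →L[ℝ] E n) : E n →ₗ[ℝ] E n) := by
    simp [hker]
  rw [hbot, Submodule.mem_bot] at hv
  exact (norm_sub_proj_pos hy).ne' (norm_eq_zero.2 hv)

theorem shell_subset_of_subset_closedBall {K : ConvexBody (E n)} {R : ℝ}
    (hK : (K : Set (E n)) ⊆ Metric.closedBall 0 R) (ε : ℝ) :
    shell K ε ⊆ Metric.closedBall 0 (R + ε) := by
  intro y hy
  rw [mem_closedBall_zero_iff]
  have h1 := mem_closedBall_zero_iff.1 (hK (proj_mem K y))
  calc ‖y‖ = ‖proj K y + (y - proj K y)‖ := by rw [add_sub_cancel]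
    _ ≤ _ := (norm_add_le _ _).trans (add_le_add h1 hy.2)

theorem volume_shell_lt_top (K : ConvexBody (E n)) (ε : ℝ) : volume (shell K ε) < ⊤ := by
  obtain ⟨R, hR⟩ := K.isBounded.subset_closedBall 0
  exact (measure_mono (shell_subset_of_subset_closedBall hR ε)).trans_lt
    measure_closedBall_lt_top

theorem choose_ne_zero (i : Fin n) : (n.choose i : ℝ≥0∞) ≠ 0 := by
  exact_mod_cast (Nat.choose_pos i.2.le).ne'

variable [Nonempty (Sph n)]

theorem measurableSet_localParallelSet (K : ConvexBody (E n)) (ε : ℝ) {η : Set (E n × Sph n)}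
    (hη : MeasurableSet η) : MeasurableSet (localParallelSet K ε η) := by
  rw [localParallelSet_eq]
  exact (measurableSet_shell K ε).inter (measurable_gaussPair K hη)

/-- The local Steiner formula with the coefficients as integrals of the Steiner densities. -/
theorem volume_localParallelSet (K : ConvexBody (E n)) {ε : ℝ} (hε : 0 < ε)
    {η : Set (E n × Sph n)} (hη : MeasurableSet η) :
    volume (localParallelSet K ε η) = ∑ k ∈ Finset.range n, ENNReal.ofReal ε ^ (k + 1) *
      ∫⁻ y in localParallelSet K 1 η, ENNReal.ofReal (steinerDensity K (k + 1) y) := by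
  have hm := measurableSet_localParallelSet K 1 hη
  have hsub : ∀ y ∈ localParallelSet K 1 η, y ∉ K := fun y hy => by
    rw [localParallelSet_eq] at hy; exact hy.1.1
  conv_lhs => rw [← mul_one ε, ← image_radial_localParallelSet K 1 η hε,
    volume_radial_image K hε hm]
  have h1 : ∀ y ∈ localParallelSet K 1 η, ENNReal.ofReal (radialJacobian K ε y)
      = ∑ k ∈ Finset.range n, ENNReal.ofReal ε ^ (k + 1) *
        ENNReal.ofReal (steinerDensity K (k + 1) y) := by
    intro y hy
    rw [radialJacobian_eq_sum, Finset.sum_range_succ', steinerDensity_zero (hsub y hy), zero_mul,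
      add_zero, ENNReal.ofReal_sum_of_nonneg fun k _ => mul_nonneg (steinerDensity_nonneg K _ y)
        (pow_nonneg hε.le _)]
    refine Finset.sum_congr rfl fun k _ => ?_
    rw [ENNReal.ofReal_mul (steinerDensity_nonneg K _ y), ENNReal.ofReal_pow hε.le, mul_comm]
  change ∫⁻ y in _, ENNReal.ofReal (radialJacobian K ε y) = _
  rw [setLIntegral_congr_fun hm h1, lintegral_finsetSum]
  · refine Finset.sum_congr rfl fun k _ => lintegral_const_mul _ ?_
    exact (measurable_steinerDensity K _).ennreal_ofReal
  · exact fun k _ => (measurable_steinerDensity K _).ennreal_ofReal.const_mul _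

/-- The pushforward of the Steiner density of degree `n - i`, restricted to the points at distance
at most one, under the map that sends `y` to its nearest point and normal direction, normalized
as in the local Steiner formula. -/
noncomputable def steinerMeasure (K : ConvexBody (E n)) (i : Fin n) : Measure (E n × Sph n) :=
  ((n : ℝ≥0∞) / (n.choose i : ℝ≥0∞)) • ((volume.restrict (shell K 1)).withDensity fun y =>
    ENNReal.ofReal (steinerDensity K (n - i) y)).map (gaussPair K)

theorem steinerMeasure_apply (K : ConvexBody (E n)) (i : Fin n) {η : Set (E n × Sph n)}
    (hη : MeasurableSet η) :
    steinerMeasure K i η = (n : ℝ≥0∞) / (n.choose i : ℝ≥0∞) *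
      ∫⁻ y in localParallelSet K 1 η, ENNReal.ofReal (steinerDensity K (n - i) y) := by
  rw [steinerMeasure, Measure.smul_apply, Measure.map_apply (measurable_gaussPair K) hη,
    withDensity_apply _ (measurable_gaussPair K hη),
    Measure.restrict_restrict (measurable_gaussPair K hη), localParallelSet_eq, Set.inter_comm,
    smul_eq_mul]

theorem satisfiesLocalSteiner_steinerMeasure (K : ConvexBody (E n)) :
    SatisfiesLocalSteiner K (steinerMeasure K) where
  finite i := by
    refine ⟨?_⟩
    rw [steinerMeasure_apply K i MeasurableSet.univ]
    refine ENNReal.mul_lt_top (ENNReal.div_lt_top (ENNReal.natCast_ne_top n) (choose_ne_zero i)) ?_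
    calc _ ≤ ∫⁻ y in localParallelSet K 1 Set.univ, 1 := lintegral_mono fun y => by
          rw [← ENNReal.ofReal_one]
          exact ENNReal.ofReal_le_ofReal (steinerDensity_le_one K (Nat.sub_le _ _) y)
      _ = volume (localParallelSet K 1 Set.univ) := by simp
      _ ≤ volume (shell K 1) := measure_mono (by
          rw [localParallelSet_eq]; exact Set.inter_subset_left)
      _ < ⊤ := volume_shell_lt_top K 1
  steiner ε hε η hη := by
    rw [volume_localParallelSet K hε hη, Finset.mul_sum, ← Finset.sum_range_reflect,
      Finset.sum_range]
    refine Finset.sum_congr rfl fun i _ => ?_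
    rw [steinerMeasure_apply K i hη, show n - 1 - (i : ℕ) + 1 = n - i by have := i.2; omega]
    set c : ℝ≥0∞ := (n.choose i : ℝ≥0∞)
    have hc : c * ((n : ℝ≥0∞) / c) = n :=
      ENNReal.mul_div_cancel (choose_ne_zero i) (ENNReal.natCast_ne_top _)
    rw [mul_assoc c, mul_left_comm _ ((n : ℝ≥0∞) / c), ← mul_assoc c, hc]

theorem supportMeasure_eq_steinerMeasure (K : ConvexBody (E n)) :
    supportMeasure K = steinerMeasure K :=
  (satisfiesLocalSteiner_steinerMeasure K).supportMeasure_eq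

theorem satisfiesLocalSteiner_supportMeasure (K : ConvexBody (E n)) :
    SatisfiesLocalSteiner K (supportMeasure K) :=
  supportMeasure_eq_steinerMeasure K ▸ satisfiesLocalSteiner_steinerMeasure K

end Density

/-! ### Integration against complex measures -/

section ComplexMeasure

variable {X Z : Type*} [MeasurableSpace X] [MeasurableSpace Z]

instance isFiniteMeasure_variation (μ : ComplexMeasure X) : IsFiniteMeasure μ.variation := by
  have hre : IsFiniteMeasure (ComplexMeasure.re μ).variation := by
    rw [← SignedMeasure.totalVariation_eq_variation, SignedMeasure.totalVariation]
    infer_instance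
  have him : IsFiniteMeasure (ComplexMeasure.im μ).variation := by
    rw [← SignedMeasure.totalVariation_eq_variation, SignedMeasure.totalVariation]
    infer_instance
  refine isFiniteMeasure_of_le
    ((ComplexMeasure.re μ).variation + (ComplexMeasure.im μ).variation)
    (VectorMeasure.variation_le_of_forall_enorm_le fun s _ => ?_)
  calc ‖μ s‖ₑ ≤ ‖(μ s).re‖ₑ + ‖(μ s).im‖ₑ := by
        rw [← ofReal_norm, ← ofReal_norm, ← ofReal_norm,
          ← ENNReal.ofReal_add (norm_nonneg _) (norm_nonneg _)]
        exact ENNReal.ofReal_le_ofReal (Complex.norm_le_abs_re_add_abs_im _)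
    _ ≤ _ := add_le_add (VectorMeasure.enorm_measure_le_variation (ComplexMeasure.re μ) s)
        (VectorMeasure.enorm_measure_le_variation (ComplexMeasure.im μ) s)

theorem integral_indicator_one_vectorMeasure (μ : ComplexMeasure X) {s : Set X}
    (hs : MeasurableSet s) : ∫ᵛ x, s.indicator (fun _ => (1 : ℝ)) x ∂•μ = μ s := by
  rw [VectorMeasure.integral_indicator_const _ hs]
  simp

/-- A complex measure on a metrizable space is determined by the integrals of bounded continuous
functions. -/
theorem ext_of_forall_integral_eq [TopologicalSpace X] [BorelSpace X] [HasOuterApproxClosed X]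
    {μ ν : ComplexMeasure X} (h : ∀ g : X →ᵇ ℝ, ∫ᵛ x, g x ∂•μ = ∫ᵛ x, g x ∂•ν) : μ = ν := by
  have key : ∀ F : Set X, IsClosed F → μ F = ν F := by
    intro F hF
    have ht : ∀ ρ : ComplexMeasure X,
        Tendsto (fun k => ∫ᵛ x, ((hF.apprSeq k x : NNReal) : ℝ) ∂•ρ) atTop (𝓝 (ρ F)) := by
      intro ρ
      rw [← integral_indicator_one_vectorMeasure ρ hF.measurableSet]
      refine VectorMeasure.tendsto_integral_of_dominated_convergence (fun _ => 1)
        (fun k => ?_) (integrable_const _) (fun k => Eventually.of_forall fun x => ?_)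
        (Eventually.of_forall fun x => ?_)
      · exact (NNReal.continuous_coe.comp (hF.apprSeq k).continuous).aestronglyMeasurable
      · rw [Real.norm_of_nonneg (NNReal.coe_nonneg _)]
        exact_mod_cast HasOuterApproxClosed.apprSeq_apply_le_one hF k x
      · have h1 := tendsto_pi_nhds.1 (HasOuterApproxClosed.tendsto_apprSeq hF) x
        have h2 := (NNReal.continuous_coe.tendsto _).comp h1
        refine h2.congr' ?_ |>.trans (le_of_eq ?_)
        · exact Eventually.of_forall fun k => rfl
        · by_cases hx : x ∈ F <;> simp [hx]
    refine tendsto_nhds_unique (ht μ) ((ht ν).congr fun k => ?_)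
    refine (h (BoundedContinuousFunction.ofNormedAddCommGroup
      (fun x => ((hF.apprSeq k x : NNReal) : ℝ))
      (NNReal.continuous_coe.comp (hF.apprSeq k).continuous) 1 fun x => ?_)).symm
    rw [Real.norm_of_nonneg (NNReal.coe_nonneg _)]
    exact_mod_cast HasOuterApproxClosed.apprSeq_apply_le_one hF k x
  refine VectorMeasure.ext_of_generateFrom {F | IsClosed F} key ?_ isPiSystem_isClosed
    (key _ isClosed_univ)
  rw [BorelSpace.measurable_eq (α := X), borel_eq_generateFrom_isClosed]

/-- Integration against the image of a complex measure with density. -/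
theorem integral_of_eq_setIntegral {m : Measure Z} {π : Z → X} (hπ : Measurable π) {h : Z → ℂ}
    (hh : Integrable h m) {μ : ComplexMeasure X}
    (hμ : ∀ β, MeasurableSet β → μ β = ∫ z in π ⁻¹' β, h z ∂m)
    {g : X → ℝ} (hg : StronglyMeasurable g) {C : ℝ} (hC : ∀ x, ‖g x‖ ≤ C) :
    ∫ᵛ x, g x ∂•μ = ∫ z, g (π z) • h z ∂m := by
  rcases isEmpty_or_nonempty X with hX | ⟨⟨x₀⟩⟩
  · have : IsEmpty Z := ⟨fun z => hX.elim (π z)⟩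
    rw [VectorMeasure.integral_of_isEmpty, integral_of_isEmpty]
  have hC0 : 0 ≤ C := (norm_nonneg _).trans (hC x₀)
  have hint : ∀ {f : X → ℝ}, StronglyMeasurable f → (∃ D, ∀ x, ‖f x‖ ≤ D) →
      Integrable (fun z => f (π z) • h z) m := fun hf ⟨D, hD⟩ =>
    hh.bdd_smul D (hf.comp_measurable hπ).aestronglyMeasurable
      (Eventually.of_forall fun z => hD _)
  have hsimple : ∀ f : SimpleFunc X ℝ, ∫ᵛ x, f x ∂•μ = ∫ z, f (π z) • h z ∂m := by
    intro f
    induction f using SimpleFunc.induction with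
    | const c hs =>
      rename_i s
      have h1 : (fun z => (Set.indicator s (fun _ => c) (π z)) • h z)
          = (π ⁻¹' s).indicator fun z => c • h z := by
        funext z
        by_cases hz : π z ∈ s <;> simp [hz]
      have h2 : ∀ x, (SimpleFunc.piecewise s hs (SimpleFunc.const X c) (SimpleFunc.const X 0)) x
          = s.indicator (fun _ => c) x := fun x => by
        by_cases hx : x ∈ s <;> simp [hx]
      simp_rw [h2]
      rw [VectorMeasure.integral_indicator_const _ hs, h1, integral_indicator (hπ hs),
        integral_smul, hμ s hs]
      simp
    | add _ hf hg' =>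
      rename_i f g' hd
      have b1 : ∀ f : SimpleFunc X ℝ, ∃ D, ∀ x, ‖f x‖ ≤ D := fun f =>
        f.exists_forall_norm_le
      simp only [SimpleFunc.coe_add, Pi.add_apply, add_smul]
      rw [VectorMeasure.integral_fun_add, integral_add (hint f.stronglyMeasurable (b1 f))
        (hint g'.stronglyMeasurable (b1 g')), hf, hg']
      · exact SimpleFunc.integrable_of_isFiniteMeasure f
      · exact SimpleFunc.integrable_of_isFiniteMeasure g'
  have hlim : ∀ x, Tendsto (fun k => hg.approxBounded C k x) atTop (𝓝 (g x)) := fun x =>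
    hg.tendsto_approxBounded_of_norm_le (hC x)
  have h1 : Tendsto (fun k => ∫ᵛ x, hg.approxBounded C k x ∂•μ) atTop (𝓝 (∫ᵛ x, g x ∂•μ)) :=
    VectorMeasure.tendsto_integral_of_dominated_convergence (fun _ => C)
      (fun k => (SimpleFunc.stronglyMeasurable _).aestronglyMeasurable) (integrable_const _)
      (fun k => Eventually.of_forall fun x => hg.norm_approxBounded_le hC0 k x)
      (Eventually.of_forall hlim)
  have h2 : Tendsto (fun k => ∫ z, hg.approxBounded C k (π z) • h z ∂m) atTop
      (𝓝 (∫ z, g (π z) • h z ∂m)) :=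
    tendsto_integral_of_dominated_convergence (fun z => C * ‖h z‖)
      (fun k => (hint (SimpleFunc.stronglyMeasurable _)
        ⟨C, hg.norm_approxBounded_le hC0 k⟩).aestronglyMeasurable) (hh.norm.const_mul C)
      (fun k => Eventually.of_forall fun z => by
        rw [norm_smul]
        exact mul_le_mul_of_nonneg_right (hg.norm_approxBounded_le hC0 k _) (norm_nonneg _))
      (Eventually.of_forall fun z => (hlim (π z)).smul_const _)
  exact tendsto_nhds_unique h1 (h2.congr fun k => (hsimple _).symm)

end ComplexMeasure

/-! ### Properties of the support measures -/

section SupportMeasure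

variable {n : ℕ}

theorem isClosed_normalCycle (K : ConvexBody (E n)) : IsClosed (normalCycle K) := by
  have : normalCycle K = {p : E n × Sph n | p.1 ∈ (K : Set (E n))} ∩
      ⋂ y ∈ K, {p | ⟪(p.2 : E n), y - p.1⟫ ≤ 0} := by
    ext p; simp [normalCycle]
  rw [this]
  refine (K.isClosed.preimage continuous_fst).inter (isClosed_biInter fun y _ => ?_)
  exact isClosed_le (by fun_prop) continuous_const

theorem mem_normalCycle_of_inter_eq {K L : ConvexBody (E n)} {U : Set (E n)} (hU : IsOpen U)
    (h : (K : Set (E n)) ∩ U = (L : Set (E n)) ∩ U) {p : E n × Sph n} (hpU : p.1 ∈ U)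
    (hp : p ∈ normalCycle K) : p ∈ normalCycle L := by
  have hpL : p.1 ∈ (L : Set (E n)) := (h ▸ ⟨hp.1, hpU⟩ : p.1 ∈ (L : Set (E n)) ∩ U).1
  refine ⟨hpL, fun y hy => ?_⟩
  -- A point of the segment from `p.1` to `y` close to `p.1` lies in `L ∩ U`, hence in `K`.
  have hcont : Tendsto (fun s : ℝ => p.1 + s • (y - p.1)) (𝓝[>] 0) (𝓝 p.1) := by
    have : Continuous fun s : ℝ => p.1 + s • (y - p.1) := by fun_prop
    simpa using (this.tendsto 0).mono_left nhdsWithin_le_nhds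
  have hev : ∀ᶠ s : ℝ in 𝓝[>] 0, s ∈ Set.Ioo (0 : ℝ) 1 := Ioo_mem_nhdsGT zero_lt_one
  obtain ⟨s, hsU, hs0, hs1⟩ := ((hcont.eventually (hU.mem_nhds hpU)).and hev).exists
  have hmem : p.1 + s • (y - p.1) ∈ (L : Set (E n)) :=
    L.convex.add_smul_sub_mem hpL hy ⟨hs0.le, hs1.le⟩
  have hK : p.1 + s • (y - p.1) ∈ (K : Set (E n)) :=
    (h.symm ▸ ⟨hmem, hsU⟩ : p.1 + s • (y - p.1) ∈ (K : Set (E n)) ∩ U).1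
  have := hp.2 _ hK
  rw [add_sub_cancel_left, inner_smul_right] at this
  exact nonpos_of_mul_nonpos_right this hs0

/-- The normal cycle is determined locally. -/
theorem normalCycle_inter_eq {K L : ConvexBody (E n)} {U : Set (E n)} (hU : IsOpen U)
    (h : (K : Set (E n)) ∩ U = (L : Set (E n)) ∩ U) {η : Set (E n × Sph n)}
    (hη : η ⊆ Prod.fst ⁻¹' U) : normalCycle K ∩ η = normalCycle L ∩ η :=
  Set.ext fun _ => ⟨fun hp => ⟨mem_normalCycle_of_inter_eq hU h (hη hp.2) hp.1, hp.2⟩,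
    fun hp => ⟨mem_normalCycle_of_inter_eq hU h.symm (hη hp.2) hp.1, hp.2⟩⟩

variable [Nonempty (Sph n)]

instance isFiniteMeasure_supportMeasure (K : ConvexBody (E n)) (i : Fin n) :
    IsFiniteMeasure (supportMeasure K i) :=
  (satisfiesLocalSteiner_supportMeasure K).finite i

theorem supportMeasure_compl_normalCycle (K : ConvexBody (E n)) (i : Fin n) :
    supportMeasure K i (normalCycle K)ᶜ = 0 := by
  have h := (satisfiesLocalSteiner_supportMeasure K).steiner 1 one_pos (normalCycle K)ᶜ
    (isClosed_normalCycle K).measurableSet.compl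
  have h0 : localParallelSet K 1 (normalCycle K)ᶜ = ∅ := by
    simp [localParallelSet]
  rw [h0, measure_empty, mul_zero, eq_comm, Finset.sum_eq_zero_iff] at h
  simpa [(Nat.choose_pos i.2.le).ne'] using h i (Finset.mem_univ i)

/-- The local Steiner polynomial of `K` at `η`. -/
noncomputable def steinerPoly (K : ConvexBody (E n)) (η : Set (E n × Sph n)) : Polynomial ℝ :=
  ∑ i : Fin n, Polynomial.monomial (n - (i : ℕ))
    ((n.choose i : ℝ) * (supportMeasure K i η).toReal)

theorem eval_steinerPoly (K : ConvexBody (E n)) {η : Set (E n × Sph n)} (hη : MeasurableSet η)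
    {ε : ℝ} (hε : 0 < ε) :
    (steinerPoly K η).eval ε = n * (volume (localParallelSet K ε η)).toReal := by
  have h := congrArg ENNReal.toReal
    ((satisfiesLocalSteiner_supportMeasure K).steiner ε hε η hη)
  rw [ENNReal.toReal_mul, ENNReal.toReal_natCast, ENNReal.toReal_sum fun i _ =>
    ENNReal.mul_ne_top (ENNReal.mul_ne_top (by simp) (by simp)) (measure_ne_top _ _)] at h
  rw [h, steinerPoly, Polynomial.eval_finsetSum]
  refine Finset.sum_congr rfl fun i _ => ?_
  simp [ENNReal.toReal_mul, ENNReal.toReal_ofReal hε.le]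
  ring

omit [Nonempty (Sph n)] in
theorem coeff_steinerPoly (K : ConvexBody (E n)) (η : Set (E n × Sph n)) (i : Fin n) :
    (steinerPoly K η).coeff (n - i) = n.choose i * (supportMeasure K i η).toReal := by
  have hij : ∀ j : Fin n, (n - (j : ℕ) = n - (i : ℕ)) ↔ j = i := by
    intro j
    rw [Fin.ext_iff]
    omega
  simp only [steinerPoly, Polynomial.finsetSum_coeff, Polynomial.coeff_monomial, hij,
    Finset.sum_ite_eq', Finset.mem_univ, if_true]

/-- If the local parallel volumes of two bodies agree up to scaling by `t`, then so do their
support measures. -/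
theorem supportMeasure_eq_of_volume_eq {K L : ConvexBody (E n)} {η η' : Set (E n × Sph n)}
    (hη : MeasurableSet η) (hη' : MeasurableSet η') {t : ℝ} (ht : 0 < t)
    (h : ∀ ε, 0 < ε → volume (localParallelSet L (t * ε) η')
      = ENNReal.ofReal (t ^ n) * volume (localParallelSet K ε η)) (i : Fin n) :
    supportMeasure L i η' = ENNReal.ofReal (t ^ (i : ℕ)) * supportMeasure K i η := by
  have hpoly : (steinerPoly L η').comp (Polynomial.C t * Polynomial.X)
      = Polynomial.C (t ^ n) * steinerPoly K η := by
    refine Polynomial.eq_of_infinite_eval_eq _ _ ((Set.Ioi_infinite (0 : ℝ)).mono fun ε hε => ?_)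
    have hε : 0 < ε := hε
    simp only [Set.mem_ofPred_eq, Polynomial.eval_comp, Polynomial.eval_mul, Polynomial.eval_C,
      Polynomial.eval_X]
    rw [eval_steinerPoly L hη' (mul_pos ht hε), eval_steinerPoly K hη hε, h ε hε,
      ENNReal.toReal_mul, ENNReal.toReal_ofReal (by positivity)]
    ring
  have hc := congrArg (fun p => Polynomial.coeff p (n - (i : ℕ))) hpoly
  simp only [Polynomial.comp_C_mul_X_coeff, Polynomial.coeff_C_mul, coeff_steinerPoly] at hc
  have hne : (n.choose i : ℝ) ≠ 0 := by exact_mod_cast (Nat.choose_pos i.2.le).ne'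
  have hpow : t ^ n = t ^ (i : ℕ) * t ^ (n - (i : ℕ)) := by
    rw [← pow_add, Nat.add_sub_cancel' i.2.le]
  have ht' : t ^ (n - (i : ℕ)) ≠ 0 := by positivity
  rw [← ENNReal.toReal_eq_toReal_iff' (measure_ne_top _ _)
    (ENNReal.mul_ne_top ENNReal.ofReal_ne_top (measure_ne_top _ _)), ENNReal.toReal_mul,
    ENNReal.toReal_ofReal (by positivity)]
  rw [hpow] at hc
  refine mul_left_cancel₀ hne (mul_right_cancel₀ ht' ?_)
  linear_combination hc

theorem supportMeasure_restrict_eq {K L : ConvexBody (E n)} {U : Set (E n)} (hU : IsOpen U)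
    (h : (K : Set (E n)) ∩ U = (L : Set (E n)) ∩ U) (i : Fin n) {β : Set (E n)}
    (hβ : MeasurableSet β) (hβU : β ⊆ U) :
    (supportMeasure K i).restrict (Prod.fst ⁻¹' β)
      = (supportMeasure L i).restrict (Prod.fst ⁻¹' β) := by
  ext η hη
  have hm : MeasurableSet (η ∩ Prod.fst ⁻¹' β) := hη.inter (measurable_fst hβ)
  rw [Measure.restrict_apply hη, Measure.restrict_apply hη]
  have := supportMeasure_eq_of_volume_eq (K := L) (L := K) hm hm one_pos (fun ε _ => by
    rw [one_mul, one_pow, ENNReal.ofReal_one, one_mul, localParallelSet, localParallelSet,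
      normalCycle_inter_eq hU h (Set.inter_subset_right.trans (Set.preimage_mono hβU))]) i
  simpa using this

/-- The action of the similarity `x ↦ t x + a` on pairs of points and normals. -/
def similarity (t : ℝ) (a : E n) (p : E n × Sph n) : E n × Sph n := (t • p.1 + a, p.2)

omit [Nonempty (Sph n)] in
theorem measurable_similarity (t : ℝ) (a : E n) : Measurable (similarity (n := n) t a) :=
  Continuous.measurable (by unfold similarity; fun_prop)

omit [Nonempty (Sph n)] in
theorem similarity_mem_normalCycle_iff {K L : ConvexBody (E n)} {t : ℝ} (ht : 0 < t) {a : E n}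
    (h : (L : Set (E n)) = (fun y => t • y + a) '' (K : Set (E n))) (p : E n × Sph n) :
    similarity t a p ∈ normalCycle L ↔ p ∈ normalCycle K := by
  have hinj : Function.Injective fun y : E n => t • y + a :=
    (add_left_injective a).comp (smul_right_injective _ ht.ne')
  have h1 : ∀ y : E n, t • y + a ∈ L ↔ y ∈ K := fun y => by
    rw [← SetLike.mem_coe, h]; exact hinj.mem_set_image
  have h2 : ∀ y, t • y + a - (t • p.1 + a) = t • (y - p.1) := fun y => by module
  constructor
  · rintro ⟨hp, hq⟩
    refine ⟨(h1 _).1 hp, fun y hy => ?_⟩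
    have := hq _ ((h1 y).2 hy)
    simp only [similarity, h2, inner_smul_right] at this
    exact nonpos_of_mul_nonpos_right this ht
  · rintro ⟨hp, hq⟩
    refine ⟨(h1 _).2 hp, fun y hy => ?_⟩
    rw [← SetLike.mem_coe, h] at hy
    obtain ⟨z, hz, rfl⟩ := hy
    simp only [similarity, h2, inner_smul_right]
    exact mul_nonpos_of_nonneg_of_nonpos ht.le (hq z hz)

omit [Nonempty (Sph n)] in
theorem localParallelSet_similarity {K L : ConvexBody (E n)} {t : ℝ} (ht : 0 < t) {a : E n}
    (h : (L : Set (E n)) = (fun y => t • y + a) '' (K : Set (E n))) (ε : ℝ)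
    (η : Set (E n × Sph n)) :
    localParallelSet L (t * ε) η
      = (fun y => t • y + a) '' localParallelSet K ε (similarity t a ⁻¹' η) := by
  ext y
  constructor
  · rintro ⟨p, ⟨hp, hpη⟩, s, hs, rfl⟩
    have hq : similarity t a (t⁻¹ • (p.1 - a), p.2) = p := by
      ext1
      · simp [similarity, smul_smul, ht.ne']
      · rfl
    refine ⟨t⁻¹ • (p.1 - a) + (t⁻¹ * s) • (p.2 : E n),
      ⟨(t⁻¹ • (p.1 - a), p.2), ⟨?_, ?_⟩, t⁻¹ * s, ⟨?_, ?_⟩, rfl⟩, ?_⟩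
    · rwa [← similarity_mem_normalCycle_iff ht h, hq]
    · rwa [Set.mem_preimage, hq]
    · exact mul_pos (inv_pos.2 ht) hs.1
    · rw [inv_mul_le_iff₀ ht]; exact hs.2
    · simp only [smul_add, smul_smul]
      rw [← mul_assoc, mul_inv_cancel₀ ht.ne', one_mul, one_smul]
      abel
  · rintro ⟨_, ⟨p, ⟨hp, hpη⟩, s, hs, rfl⟩, rfl⟩
    refine ⟨similarity t a p, ⟨(similarity_mem_normalCycle_iff ht h p).2 hp, hpη⟩, t * s,
      ⟨mul_pos ht hs.1, mul_le_mul_of_nonneg_left hs.2 ht.le⟩, ?_⟩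
    simp only [similarity]
    module

theorem supportMeasure_similarity {K L : ConvexBody (E n)} {t : ℝ} (ht : 0 < t) {a : E n}
    (h : (L : Set (E n)) = (fun y => t • y + a) '' (K : Set (E n))) (i : Fin n) :
    supportMeasure L i
      = ENNReal.ofReal (t ^ (i : ℕ)) • (supportMeasure K i).map (similarity t a) := by
  ext η hη
  have hm := measurable_similarity t a hη
  rw [Measure.smul_apply, Measure.map_apply (measurable_similarity t a) hη, smul_eq_mul]
  refine supportMeasure_eq_of_volume_eq hm hη ht (fun ε _ => ?_) i
  rw [localParallelSet_similarity ht h,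
    show (fun y : E n => t • y + a) = (fun y => y + a) ∘ (fun y => t • y) from rfl,
    Set.image_comp, Set.image_add_right, measure_preimage_add_right, Set.image_smul,
    Measure.addHaar_smul, finrank_euclideanSpace_fin, abs_of_pos (by positivity)]

end SupportMeasure

/-! ### Weak continuity of the support measure of degree `n - 1` -/

section WeakContinuity

variable {n : ℕ}

theorem shell_union_eq (K : ConvexBody (E n)) (ε : ℝ) :
    {y | ‖y - proj K y‖ ≤ ε} = (K : Set (E n)) + Metric.closedBall 0 ε := by
  ext y
  constructor
  · intro hy
    exact ⟨proj K y, proj_mem K y, y - proj K y, mem_closedBall_zero_iff.2 hy, by simp⟩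
  · rintro ⟨x, hx, z, hz, rfl⟩
    refine (norm_sub_proj_le K _ hx).trans ?_
    simpa using hz

/-- The surface of the parallel body at positive distance is contained in the frontier of a convex
set. -/
theorem volume_dist_eq (K : ConvexBody (E n)) {ε : ℝ} (hε : 0 < ε) :
    volume {y | ‖y - proj K y‖ = ε} = 0 := by
  have hconv : Convex ℝ {y | ‖y - proj K y‖ ≤ ε} := by
    rw [shell_union_eq]
    exact K.convex.add (convex_closedBall 0 ε)
  refine measure_mono_null (fun y hy => ?_) (hconv.addHaar_frontier volume)
  have hy : ‖y - proj K y‖ = ε := hy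
  refine ⟨subset_closure hy.le, fun hint => ?_⟩
  -- Moving outwards along the normal ray increases the distance.
  have hcont : Tendsto (fun t : ℝ => radial K t y) (𝓝[>] 1) (𝓝 y) := by
    have : Continuous fun t : ℝ => radial K t y := by unfold radial; fun_prop
    simpa [radial] using (this.tendsto 1).mono_left nhdsWithin_le_nhds
  obtain ⟨t, ht, ht1⟩ := ((hcont.eventually (isOpen_interior.mem_nhds hint)).and
    self_mem_nhdsWithin).exists
  have ht1 : 1 < t := ht1
  have h := interior_subset ht
  rw [Set.mem_ofPred_eq, radial_sub_proj K y (by linarith), norm_smul, hy, Real.norm_eq_abs,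
    abs_of_pos (by linarith)] at h
  nlinarith

/-- The metric projection is Hölder continuous with exponent `1 / 2` as a function of the body. -/
theorem norm_proj_sub_proj_sq_le (K L : ConvexBody (E n)) (y : E n) {δ : ℝ}
    (hKL : ∀ x ∈ K, ∃ x' ∈ L, ‖x - x'‖ ≤ δ) (hLK : ∀ x ∈ L, ∃ x' ∈ K, ‖x - x'‖ ≤ δ) :
    ‖proj L y - proj K y‖ ^ 2 ≤ δ * (‖y - proj K y‖ + ‖y - proj L y‖) := by
  obtain ⟨a, ha, hab⟩ := hKL _ (proj_mem K y)
  obtain ⟨b, hb, hba⟩ := hLK _ (proj_mem L y)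
  have h1 := proj_inner_le K y hb
  have h2 := proj_inner_le L y ha
  have h3 := (real_inner_le_norm (y - proj K y) (proj L y - b)).trans
    (mul_le_mul_of_nonneg_left hba (norm_nonneg _))
  have h4 := (real_inner_le_norm (y - proj L y) (proj K y - a)).trans
    (mul_le_mul_of_nonneg_left hab (norm_nonneg _))
  have h5 : ‖proj L y - proj K y‖ ^ 2 = ⟪y - proj K y, proj L y - b⟫ + ⟪y - proj K y, b - proj K y⟫
      + ⟪y - proj L y, proj K y - a⟫ + ⟪y - proj L y, a - proj L y⟫ := by
    rw [← real_inner_self_eq_norm_sq, ← inner_add_right, add_assoc, ← inner_add_right,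
      sub_add_sub_cancel, sub_add_sub_cancel, ← neg_sub (proj L y) (proj K y), inner_neg_right,
      ← sub_eq_add_neg, ← inner_sub_left, sub_sub_sub_cancel_left]
  linarith

theorem exists_norm_sub_le_of_dist_lt {K L : ConvexBody (E n)} {δ : ℝ} (h : dist K L < δ) {x : E n}
    (hx : x ∈ K) : ∃ x' ∈ L, ‖x - x'‖ ≤ δ := by
  obtain ⟨x', hx', hd⟩ := Metric.exists_dist_lt_of_hausdorffDist_lt
    (s := (K : Set (E n))) (t := (L : Set (E n))) hx h ConvexBody.hausdorffEDist_ne_top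
  exact ⟨x', hx', by rw [← dist_eq_norm]; exact hd.le⟩

variable {K : ℕ → ConvexBody (E n)} {K₀ : ConvexBody (E n)}

theorem tendsto_proj (hK : Tendsto K atTop (𝓝 K₀)) (y : E n) :
    Tendsto (fun j => proj (K j) y) atTop (𝓝 (proj K₀ y)) := by
  set B : ℝ := 2 * ‖y - proj K₀ y‖ + 1
  rw [tendsto_iff_norm_sub_tendsto_zero]
  have hsq : Tendsto (fun j => ‖proj (K j) y - proj K₀ y‖ ^ 2) atTop (𝓝 0) := by
    rw [Metric.tendsto_atTop]
    intro ε hε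
    have hB : 0 < B := by positivity
    set δ := min 1 (ε / (2 * B))
    have hδ : 0 < δ := lt_min one_pos (by positivity)
    obtain ⟨N, hN⟩ := Metric.tendsto_atTop.1 hK δ hδ
    refine ⟨N, fun j hj => ?_⟩
    have h1 : ∀ x ∈ K₀, ∃ x' ∈ K j, ‖x - x'‖ ≤ δ := fun x hx =>
      exists_norm_sub_le_of_dist_lt (by rw [dist_comm]; exact hN j hj) hx
    have h2 : ∀ x ∈ K j, ∃ x' ∈ K₀, ‖x - x'‖ ≤ δ := fun x hx =>
      exists_norm_sub_le_of_dist_lt (hN j hj) hx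
    have h3 := norm_proj_sub_proj_sq_le K₀ (K j) y h1 h2
    have h4 : ‖y - proj (K j) y‖ ≤ ‖y - proj K₀ y‖ + 1 := by
      obtain ⟨x', hx', hx⟩ := h1 _ (proj_mem K₀ y)
      refine (norm_sub_proj_le (K j) y hx').trans ?_
      calc ‖y - x'‖ = ‖(y - proj K₀ y) + (proj K₀ y - x')‖ := by rw [sub_add_sub_cancel]
        _ ≤ _ := (norm_add_le _ _).trans (by
          have := hx.trans (min_le_left 1 (ε / (2 * B)))
          linarith)
    have h5 : δ * (‖y - proj K₀ y‖ + ‖y - proj (K j) y‖) ≤ δ * B :=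
      mul_le_mul_of_nonneg_left (by simp only [B]; linarith) hδ.le
    have h6 : δ * B ≤ ε / 2 := by
      calc δ * B ≤ ε / (2 * B) * B := mul_le_mul_of_nonneg_right (min_le_right _ _) hB.le
        _ = ε / 2 := by field_simp
    rw [Real.dist_0_eq_abs, abs_of_nonneg (sq_nonneg _)]
    linarith
  have h := (Real.continuous_sqrt.tendsto 0).comp hsq
  rw [Real.sqrt_zero] at h
  exact h.congr fun j => Real.sqrt_sq (norm_nonneg _)

/-- Interior points of the limit of a sequence of convex bodies are eventually in the bodies. -/
theorem eventually_mem_of_mem_interior (hK : Tendsto K atTop (𝓝 K₀)) {y : E n}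
    (hy : y ∈ interior (K₀ : Set (E n))) : ∀ᶠ j in atTop, y ∈ K j := by
  obtain ⟨r, hr, hball⟩ := Metric.isOpen_iff.1 isOpen_interior y hy
  filter_upwards [Metric.tendsto_atTop'.1 hK (r / 4) (by positivity) |>.elim fun N hN =>
    (eventually_gt_atTop N).mono fun j hj => hN j hj] with j hj
  by_contra hyj
  have hpos := norm_sub_proj_pos hyj
  set v := y - proj (K j) y
  set z := y + (r / 2 / ‖v‖) • v with hz
  have hzn : ‖z - y‖ = r / 2 := by
    rw [hz, add_sub_cancel_left, norm_smul, Real.norm_of_nonneg (by positivity)]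
    field_simp
  have hzK : z ∈ K₀ := by
    have : z ∈ Metric.ball y r := by rw [mem_ball_iff_norm, hzn]; linarith
    exact interior_subset (hball this)
  obtain ⟨x, hx, hxz⟩ := exists_norm_sub_le_of_dist_lt (by rw [dist_comm]; exact hj) hzK
  have h1 : ⟪v, x - proj (K j) y⟫ ≤ 0 := proj_inner_le (K j) y hx
  have h2 := (real_inner_le_norm v (z - x)).trans
    (mul_le_mul_of_nonneg_left hxz (norm_nonneg _))
  have h3 : ⟪v, z - proj (K j) y⟫ = ‖v‖ ^ 2 + r / 2 * ‖v‖ := by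
    have : z - proj (K j) y = v + (r / 2 / ‖v‖) • v := by rw [hz]; simp only [v]; abel
    rw [this, inner_add_right, inner_smul_right, real_inner_self_eq_norm_sq]
    field_simp
  have h4 : ⟪v, z - proj (K j) y⟫ = ⟪v, z - x⟫ + ⟪v, x - proj (K j) y⟫ := by
    rw [← inner_add_right, sub_add_sub_cancel]
  nlinarith

variable [Nonempty (Sph n)]

/-- Pointwise convergence of the integrand off a null set, for the use of dominated convergence. -/
theorem tendsto_indicator_shell (hK : Tendsto K atTop (𝓝 K₀)) {ε : ℝ} {φ : E n × Sph n → ℂ}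
    (hφ : Continuous φ) {y : E n} (hy : y ∉ frontier (K₀ : Set (E n)))
    (hyε : ‖y - proj K₀ y‖ ≠ ε) :
    Tendsto (fun j => (shell (K j) ε).indicator (fun y => φ (gaussPair (K j) y)) y) atTop
      (𝓝 ((shell K₀ ε).indicator (fun y => φ (gaussPair K₀ y)) y)) := by
  by_cases hyK : y ∈ K₀
  · have hint : y ∈ interior (K₀ : Set (E n)) := by
      by_contra h
      exact hy ⟨subset_closure hyK, h⟩
    refine tendsto_const_nhds.congr' ?_
    filter_upwards [eventually_mem_of_mem_interior hK hint] with j hj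
    rw [Set.indicator_of_notMem (fun h => h.1 hyK), Set.indicator_of_notMem (fun h => h.1 hj)]
  · have hp := tendsto_proj hK y
    have hn : Tendsto (fun j => ‖y - proj (K j) y‖) atTop (𝓝 ‖y - proj K₀ y‖) :=
      (tendsto_const_nhds.sub hp).norm
    have hpos := norm_sub_proj_pos hyK
    have hnot : ∀ᶠ j in atTop, y ∉ K j := by
      filter_upwards [hn.eventually (lt_mem_nhds hpos)] with j hj hmem
      rw [proj_of_mem hmem, sub_self, norm_zero] at hj
      exact lt_irrefl _ hj
    rcases lt_or_gt_of_ne hyε with hlt | hgt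
    · have hdir : Tendsto (fun j => normalDir (K j) y) atTop (𝓝 (normalDir K₀ y)) := by
        rw [tendsto_subtype_rng, coe_normalDir hyK]
        refine ((hn.inv₀ hpos.ne').smul (tendsto_const_nhds.sub hp)).congr' ?_
        filter_upwards [hnot] with j hj
        rw [coe_normalDir hj]
      rw [Set.indicator_of_mem (show y ∈ shell K₀ ε from ⟨hyK, hlt.le⟩)]
      refine ((hφ.tendsto _).comp (hp.prodMk_nhds hdir)).congr' ?_
      filter_upwards [hnot, hn.eventually (gt_mem_nhds hlt)] with j hj hj2
      rw [Set.indicator_of_mem (show y ∈ shell (K j) ε from ⟨hj, hj2.le⟩)]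
      rfl
    · rw [Set.indicator_of_notMem (fun h => absurd h.2 (not_le.2 hgt))]
      refine tendsto_const_nhds.congr' ?_
      filter_upwards [hn.eventually (lt_mem_nhds hgt)] with j hj2
      rw [Set.indicator_of_notMem (fun h => absurd h.2 (not_le.2 hj2))]

theorem tendsto_integral_shell (hK : Tendsto K atTop (𝓝 K₀)) {ε : ℝ} (hε : 0 < ε)
    {φ : E n × Sph n → ℂ} (hφ : Continuous φ) {C : ℝ} (hC : ∀ p, ‖φ p‖ ≤ C) :
    Tendsto (fun j => ∫ y in shell (K j) ε, φ (gaussPair (K j) y)) atTop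
      (𝓝 (∫ y in shell K₀ ε, φ (gaussPair K₀ y))) := by
  obtain ⟨R, hR⟩ := K₀.isBounded.subset_closedBall 0
  simp_rw [← integral_indicator (measurableSet_shell _ ε)]
  have hmeas : ∀ L : ConvexBody (E n), Measurable
      ((shell L ε).indicator (fun y => φ (gaussPair L y))) := fun L =>
    (hφ.measurable.comp (measurable_gaussPair L)).indicator (measurableSet_shell L ε)
  have hC0 : 0 ≤ C := (norm_nonneg _).trans (hC (0, Classical.arbitrary _))
  refine tendsto_integral_filter_of_dominated_convergence
    ((Metric.closedBall (0 : E n) (R + 1 + ε)).indicator fun _ => C)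
    (Eventually.of_forall fun j => (hmeas _).aestronglyMeasurable) ?_ ?_ ?_
  · filter_upwards [Metric.tendsto_nhds.1 hK 1 one_pos] with j hj
    refine Eventually.of_forall fun y => ?_
    have hsub : (K j : Set (E n)) ⊆ Metric.closedBall 0 (R + 1) := fun x hx => by
      obtain ⟨x', hx', hd⟩ := exists_norm_sub_le_of_dist_lt hj hx
      have := mem_closedBall_zero_iff.1 (hR hx')
      rw [mem_closedBall_zero_iff]
      calc ‖x‖ = ‖x' + (x - x')‖ := by rw [add_sub_cancel]
        _ ≤ _ := (norm_add_le _ _).trans (by linarith)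
    by_cases hy : y ∈ shell (K j) ε
    · rw [Set.indicator_of_mem hy,
        Set.indicator_of_mem (shell_subset_of_subset_closedBall hsub ε hy)]
      exact hC _
    · rw [Set.indicator_of_notMem hy, norm_zero]
      exact Set.indicator_nonneg (fun _ _ => hC0) _
  · exact (integrable_indicator_iff Metric.isClosed_closedBall.measurableSet).2
      (integrableOn_const measure_closedBall_lt_top.ne)
  · filter_upwards [measure_eq_zero_iff_ae_notMem.1 (K₀.convex.addHaar_frontier volume),
      measure_eq_zero_iff_ae_notMem.1 (volume_dist_eq K₀ hε)] with y h1 h2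
    exact tendsto_indicator_shell hK hφ h1 h2

theorem integral_shell_eq_sum (K : ConvexBody (E n)) {ε : ℝ} (hε : 0 < ε)
    {φ : E n × Sph n → ℂ} (hφ : Continuous φ) {C : ℝ} (hC : ∀ p, ‖φ p‖ ≤ C) :
    (n : ℂ) * ∫ y in shell K ε, φ (gaussPair K y)
      = ∑ i : Fin n, (n.choose i : ℂ) * (ε : ℂ) ^ (n - (i : ℕ)) * ∫ p, φ p ∂supportMeasure K i := by
  have hmeas : (n : ℝ≥0∞) • (volume.restrict (shell K ε)).map (gaussPair K)
      = ∑ i : Fin n, ((n.choose i : ℝ≥0∞) * ENNReal.ofReal ε ^ (n - (i : ℕ))) •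
        supportMeasure K i := by
    ext η hη
    rw [Measure.smul_apply, Measure.map_apply (measurable_gaussPair K) hη,
      Measure.restrict_apply (measurable_gaussPair K hη), Set.inter_comm, ← localParallelSet_eq,
      smul_eq_mul, (satisfiesLocalSteiner_supportMeasure K).steiner ε hε η hη,
      Measure.finsetSum_apply]
    rfl
  have hint : ∀ i, Integrable φ (supportMeasure K i) := fun i =>
    Integrable.of_bound hφ.aestronglyMeasurable C (Eventually.of_forall hC)
  have h := congrArg (fun m => ∫ p, φ p ∂m) hmeas
  rw [integral_smul_measure, integral_map (measurable_gaussPair K).aemeasurable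
    hφ.aestronglyMeasurable, integral_finsetSum_measure fun i _ =>
      (hint i).smul_measure (ENNReal.mul_ne_top (by simp) (by simp))] at h
  simp only [integral_smul_measure, ENNReal.toReal_natCast, ENNReal.toReal_mul, ENNReal.toReal_pow,
    ENNReal.toReal_ofReal hε.le, Complex.real_smul] at h
  rw [Complex.ofReal_natCast] at h
  rw [h]
  refine Finset.sum_congr rfl fun i _ => ?_
  push_cast
  ring

omit [Nonempty (Sph n)] in
/-- The Lagrange coefficients at the nodes `1, …, n` extract the linear coefficient of a polynomial
without constant term. -/
theorem sum_lagrangeCoeff_mul_pow {m : ℕ} (hm : 1 ≤ m) (hmn : m ≤ n) :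
    ∑ j ∈ Finset.range n, lagrangeCoeff n 1 (j + 1) * ((j + 1 : ℕ) : ℝ) ^ m
      = if m = 1 then 1 else 0 := by
  have h := coeff_eq_sum_lagrangeCoeff (n := n) (P := Polynomial.X ^ m)
    (by rw [Polynomial.natDegree_X_pow]; exact hmn) 1
  rw [Finset.sum_range_succ', Polynomial.coeff_X_pow] at h
  simp only [Polynomial.eval_pow, Polynomial.eval_X, Nat.cast_zero,
    zero_pow (Nat.one_le_iff_ne_zero.1 hm), mul_zero, add_zero] at h
  rw [← h]
  simp only [eq_comm]

/-- The support measure of degree `n - 1` is a combination of images of Lebesgue measure on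
shells. -/
theorem integral_supportMeasure_eq_sum (hn : n - 1 < n) (K : ConvexBody (E n))
    {φ : E n × Sph n → ℂ} (hφ : Continuous φ) {C : ℝ} (hC : ∀ p, ‖φ p‖ ≤ C) :
    ∫ p, φ p ∂supportMeasure K ⟨n - 1, hn⟩ = ∑ j ∈ Finset.range n,
      (lagrangeCoeff n 1 (j + 1) : ℂ) *
        ∫ y in shell K ((j + 1 : ℕ) : ℝ), φ (gaussPair K y) := by
  have hn0 : (n : ℂ) ≠ 0 := by exact_mod_cast (by omega : n ≠ 0)
  refine mul_left_cancel₀ hn0 ?_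
  rw [Finset.mul_sum]
  simp_rw [mul_left_comm (n : ℂ)]
  have h1 : ∀ j ∈ Finset.range n, (lagrangeCoeff n 1 (j + 1) : ℂ) * ((n : ℂ) *
      ∫ y in shell K ((j + 1 : ℕ) : ℝ), φ (gaussPair K y)) = ∑ i : Fin n,
      (n.choose i : ℂ) * (∫ p, φ p ∂supportMeasure K i) *
        ((lagrangeCoeff n 1 (j + 1) * ((j + 1 : ℕ) : ℝ) ^ (n - (i : ℕ)) : ℝ) : ℂ) := by
    intro j _
    rw [integral_shell_eq_sum K (by positivity) hφ hC, Finset.mul_sum]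
    refine Finset.sum_congr rfl fun i _ => ?_
    push_cast
    ring
  rw [Finset.sum_congr rfl h1, Finset.sum_comm]
  simp_rw [← Finset.mul_sum, ← Complex.ofReal_sum]
  have h2 : ∀ i : Fin n, ∑ j ∈ Finset.range n,
      lagrangeCoeff n 1 (j + 1) * ((j + 1 : ℕ) : ℝ) ^ (n - (i : ℕ))
      = if i = ⟨n - 1, hn⟩ then 1 else 0 := fun i => by
    rw [sum_lagrangeCoeff_mul_pow (by omega) (by omega)]
    congr 1
    rw [Fin.ext_iff]
    simp only [eq_iff_iff]
    omega
  simp_rw [h2]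
  rw [Finset.sum_eq_single ⟨n - 1, hn⟩ (fun i _ hi => by simp [hi]) (by simp)]
  simp only [if_true, Complex.ofReal_one, mul_one]
  have : n.choose (n - 1) = n := by
    rw [← Nat.choose_symm (by omega : n - 1 ≤ n)]
    rw [show n - (n - 1) = 1 by omega, Nat.choose_one_right]
  rw [this]

/-- The support measure of degree `n - 1` depends weakly continuously on the body. -/
theorem tendsto_integral_supportMeasure (hn : n - 1 < n) (hK : Tendsto K atTop (𝓝 K₀))
    {φ : E n × Sph n → ℂ} (hφ : Continuous φ) {C : ℝ} (hC : ∀ p, ‖φ p‖ ≤ C) :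
    Tendsto (fun j => ∫ p, φ p ∂supportMeasure (K j) ⟨n - 1, hn⟩) atTop
      (𝓝 (∫ p, φ p ∂supportMeasure K₀ ⟨n - 1, hn⟩)) := by
  simp_rw [integral_supportMeasure_eq_sum hn _ hφ hC]
  exact tendsto_finsetSum _ fun j _ =>
    (tendsto_integral_shell hK (by positivity) hφ hC).const_mul _

end WeakContinuity

/-! ### The curvature measure with a given density -/

section Density

variable {n : ℕ}

theorem exists_norm_le_sph (f : C(Sph n, ℂ)) : ∃ C, ∀ u, ‖f u‖ ≤ C := by
  obtain ⟨C, hC⟩ := (isCompact_range f.continuous).isBounded.exists_norm_le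
  exact ⟨C, fun u => hC _ ⟨u, rfl⟩⟩

/-- The curvature measure `β ↦ ∫_{π⁻¹(β)} f(u) dΘ_{n-1}(K, (x, u))`. -/
noncomputable def curvatureOfDensity (hn : n - 1 < n) (f : C(Sph n, ℂ)) (K : ConvexBody (E n)) :
    ComplexMeasure (E n) :=
  ((supportMeasure K ⟨n - 1, hn⟩).withDensityᵥ fun p => f p.2).map Prod.fst

variable [Nonempty (Sph n)] (hn : n - 1 < n) (f : C(Sph n, ℂ))

theorem integrable_density (K : ConvexBody (E n)) (i : Fin n) :
    Integrable (fun p : E n × Sph n => f p.2) (supportMeasure K i) := by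
  obtain ⟨C, hC⟩ := exists_norm_le_sph f
  exact Integrable.of_bound (f.continuous.comp continuous_snd).aestronglyMeasurable C
    (Eventually.of_forall fun p => hC p.2)

theorem curvatureOfDensity_apply (K : ConvexBody (E n)) {β : Set (E n)} (hβ : MeasurableSet β) :
    curvatureOfDensity hn f K β
      = ∫ p in Prod.fst ⁻¹' β, f p.2 ∂supportMeasure K ⟨n - 1, hn⟩ := by
  rw [curvatureOfDensity, VectorMeasure.map_apply _ measurable_fst hβ,
    withDensityᵥ_apply (integrable_density f K _) (measurable_fst hβ)]

theorem integral_curvatureOfDensity (K : ConvexBody (E n)) (g : E n →ᵇ ℝ) :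
    ∫ᵛ x, g x ∂•(curvatureOfDensity hn f K)
      = ∫ p, g p.1 • f p.2 ∂supportMeasure K ⟨n - 1, hn⟩ :=
  integral_of_eq_setIntegral measurable_fst (integrable_density f K _)
    (fun _ hβ => curvatureOfDensity_apply hn f K hβ) g.continuous.stronglyMeasurable
    g.norm_coe_le_norm

theorem curvatureOfDensity_similarity {K L : ConvexBody (E n)} {t : ℝ} (ht : 0 < t) {a : E n}
    (h : (L : Set (E n)) = (fun y => t • y + a) '' (K : Set (E n))) {β : Set (E n)}
    (hβ : MeasurableSet β) :
    curvatureOfDensity hn f L ((fun y => t • y + a) '' β)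
      = ((t ^ (n - 1) : ℝ) : ℂ) * curvatureOfDensity hn f K β := by
  have hinj : Function.Injective fun y : E n => t • y + a :=
    (add_left_injective a).comp (smul_right_injective _ ht.ne')
  have hemb : MeasurableEmbedding fun y : E n => t • y + a :=
    (Continuous.measurableEmbedding (by fun_prop) hinj)
  have hβ' := hemb.measurableSet_image.2 hβ
  rw [curvatureOfDensity_apply hn f L hβ', curvatureOfDensity_apply hn f K hβ,
    supportMeasure_similarity ht h, Measure.restrict_smul, integral_smul_measure,
    setIntegral_map (measurable_fst hβ') (by fun_prop)
      (measurable_similarity t a).aemeasurable,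
    ENNReal.toReal_ofReal (by positivity), Complex.real_smul]
  congr 2
  have : similarity t a ⁻¹' (Prod.fst ⁻¹' ((fun y => t • y + a) '' β))
      = (Prod.fst ⁻¹' β : Set (E n × Sph n)) := by
    ext p
    exact hinj.mem_set_image
  rw [this]

theorem curvatureOfDensity_isCurvatureMeasure :
    IsCurvatureMeasure (curvatureOfDensity hn f) where
  locality K L U hU h β hβ hβU := by
    rw [curvatureOfDensity_apply hn f K hβ, curvatureOfDensity_apply hn f L hβ,
      supportMeasure_restrict_eq hU h _ hβ hβU]
  translation_invariance K β hβ x := by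
    have h := curvatureOfDensity_similarity hn f (K := K) (L := translate K x) one_pos (a := x)
      (by simp only [one_smul]; rfl) hβ
    simpa using h
  continuity K K₀ hK g := by
    obtain ⟨C, hC⟩ := exists_norm_le_sph f
    simp_rw [integral_curvatureOfDensity]
    refine tendsto_integral_supportMeasure hn hK (C := ‖g‖ * C) (by fun_prop) fun p => ?_
    rw [norm_smul]
    exact mul_le_mul (g.norm_coe_le_norm _) (hC _) (norm_nonneg _) (norm_nonneg _)

theorem curvatureOfDensity_mem_curv : curvatureOfDensity hn f ∈ Curv n ((n : ℝ) - 1) := by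
  refine ⟨curvatureOfDensity_isCurvatureMeasure hn f, fun K β hβ t ht => ?_⟩
  have h := curvatureOfDensity_similarity hn f (K := K) (L := t • K) ht (a := 0)
    (by simp only [add_zero]; rfl) hβ
  have hpow : t ^ ((n : ℝ) - 1) = t ^ (n - 1) := by
    rw [← Real.rpow_natCast, Nat.cast_sub (by omega), Nat.cast_one]
  rw [hpow, ← h]
  simp only [add_zero]
  rfl

end Density

section Sub

variable {n : ℕ}

theorem sub_mem_curv {Φ Ψ : ConvexBody (E n) → ComplexMeasure (E n)} {α : ℝ} (hΦ : Φ ∈ Curv n α)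
    (hΨ : Ψ ∈ Curv n α) : (fun K => Φ K - Ψ K) ∈ Curv n α := by
  refine ⟨⟨fun K L U hU h β hβ hβU => ?_, fun K β hβ x => ?_, fun K K₀ hK g => ?_⟩,
    fun K β hβ t ht => ?_⟩
  · simp only [sub_apply, hΦ.1.locality K L U hU h β hβ hβU,
      hΨ.1.locality K L U hU h β hβ hβU]
  · simp only [sub_apply, hΦ.1.translation_invariance K β hβ x,
      hΨ.1.translation_invariance K β hβ x]
  · have hint : ∀ μ : ComplexMeasure (E n), μ.Integrable g := fun μ =>
      Integrable.of_bound g.continuous.aestronglyMeasurable ‖g‖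
        (Eventually.of_forall g.norm_coe_le_norm)
    simp_rw [VectorMeasure.integral_sub_vectorMeasure (hint _) (hint _)]
    exact (hΦ.1.continuity K K₀ hK g).sub (hΨ.1.continuity K K₀ hK g)
  · simp only [sub_apply, hΦ.2 K β hβ t ht, hΨ.2 K β hβ t ht, mul_sub]

end Sub

/-! ### Differentiation of complex measures along balls -/

section Differentiation

variable {n : ℕ}

/-- With `m` the sum of `ρ` and the positive and negative parts of `s` on `S`, the densities of the
two parts with respect to `m` agree almost everywhere on `S`. -/
theorem signedMeasure_eq_zero_of_closedBall {s : SignedMeasure (E n)} {ρ : Measure (E n)}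
    [IsFiniteMeasure ρ] {S : Set (E n)} (hS : MeasurableSet S)
    (h : ∀ x ∈ S, ∃ C : ℝ, ∀ᶠ r in 𝓝[>] (0 : ℝ),
      |s (Metric.closedBall x r ∩ S)| ≤ C * r * (ρ (Metric.closedBall x r)).toReal)
    {β : Set (E n)} (hβ : MeasurableSet β) (hβS : β ⊆ S) : s β = 0 := by
  let sS : SignedMeasure (E n) := s.restrict S
  set p := sS.toJordanDecomposition.posPart
  set q := sS.toJordanDecomposition.negPart
  have hpq : ∀ {A : Set (E n)}, MeasurableSet A → s (A ∩ S) = (p A).toReal - (q A).toReal := by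
    intro A hA
    have := sS.apply_eq_posPart_real_sub_negPart_real hA
    rwa [VectorMeasure.restrict_apply _ hS hA] at this
  set m := ρ + (p + q)
  have hpm : p ≪ m := Measure.absolutelyContinuous_of_le
    ((Measure.le_add_right le_rfl).trans (Measure.le_add_left le_rfl))
  have hqm : q ≪ m := Measure.absolutelyContinuous_of_le
    ((Measure.le_add_left le_rfl).trans (Measure.le_add_left le_rfl))
  have hρm : ρ ≤ m := Measure.le_add_right le_rfl
  have hae : ∀ᵐ x ∂m, x ∈ S → p.rnDeriv m x = q.rnDeriv m x := by
    filter_upwards [Besicovitch.ae_tendsto_rnDeriv p m, Besicovitch.ae_tendsto_rnDeriv q m,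
      p.rnDeriv_lt_top m, q.rnDeriv_lt_top m] with x h1 h2 h3 h4 hx
    obtain ⟨C, hC⟩ := h x hx
    have h5 := ((ENNReal.tendsto_toReal h3.ne).comp h1).sub ((ENNReal.tendsto_toReal h4.ne).comp h2)
    have h6 : Tendsto (fun r => |C| * r) (𝓝[>] (0 : ℝ)) (𝓝 0) := by
      have : Continuous fun r : ℝ => |C| * r := by fun_prop
      simpa using (this.tendsto 0).mono_left nhdsWithin_le_nhds
    have h7 := squeeze_zero_norm' (f := fun r =>
      (p (Metric.closedBall x r) / m (Metric.closedBall x r)).toReal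
        - (q (Metric.closedBall x r) / m (Metric.closedBall x r)).toReal) ?_ h6
    · have h8 := tendsto_nhds_unique h5 h7
      rw [sub_eq_zero] at h8
      exact (ENNReal.toReal_eq_toReal_iff' h3.ne h4.ne).1 h8
    · filter_upwards [hC, self_mem_nhdsWithin] with r hr (hr0 : 0 < r)
      rw [hpq Metric.isClosed_closedBall.measurableSet] at hr
      rw [ENNReal.toReal_div, ENNReal.toReal_div, ← sub_div, Real.norm_eq_abs, abs_div]
      have hm0 : 0 ≤ (m (Metric.closedBall x r)).toReal := ENNReal.toReal_nonneg
      rw [abs_of_nonneg hm0]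
      refine div_le_of_le_mul₀ hm0 (by positivity) (hr.trans ?_)
      calc C * r * (ρ (Metric.closedBall x r)).toReal
          ≤ |C| * r * (ρ (Metric.closedBall x r)).toReal := by
            gcongr; exact le_abs_self C
        _ ≤ |C| * r * (m (Metric.closedBall x r)).toReal := by
            gcongr
            exact measure_ne_top _ _
  have hpβ : p β = q β := by
    rw [← Measure.setLIntegral_rnDeriv hpm β, ← Measure.setLIntegral_rnDeriv hqm β]
    exact setLIntegral_congr_fun_ae hβ (hae.mono fun x hx hxβ => hx (hβS hxβ))
  have := hpq hβ
  rwa [Set.inter_eq_left.2 hβS, hpβ, sub_self] at this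

/-- A complex measure on `S` which is, on small balls centred in `S`, negligible with respect to a
finite measure vanishes on `S`, by the Besicovitch differentiation theorem. -/
theorem variation_eq_zero_of_closedBall {μ : ComplexMeasure (E n)} {ρ : Measure (E n)}
    [IsFiniteMeasure ρ] {S : Set (E n)} (hS : MeasurableSet S)
    (h : ∀ x ∈ S, ∃ C : ℝ, ∀ᶠ r in 𝓝[>] (0 : ℝ),
      ‖μ (Metric.closedBall x r ∩ S)‖ ≤ C * r * (ρ (Metric.closedBall x r)).toReal) :
    μ.variation S = 0 := by
  rw [VectorMeasure.variation_apply_eq_zero hS]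
  intro β hβS hβ
  refine Complex.ext ?_ ?_
  · refine signedMeasure_eq_zero_of_closedBall (s := ComplexMeasure.re μ) (ρ := ρ) hS
      (fun x hx => ?_) hβ hβS
    obtain ⟨C, hC⟩ := h x hx
    exact ⟨C, hC.mono fun r hr => (Complex.abs_re_le_norm _).trans hr⟩
  · refine signedMeasure_eq_zero_of_closedBall (s := ComplexMeasure.im μ) (ρ := ρ) hS
      (fun x hx => ?_) hβ hβS
    obtain ⟨C, hC⟩ := h x hx
    exact ⟨C, hC.mono fun r hr => (Complex.abs_im_le_norm _).trans hr⟩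

/-- The ratio `s (closedBall x r) / volume (closedBall x r)` converges for almost every `x`, which
is incompatible with an order of magnitude `r⁻¹`. -/
theorem signedMeasure_closedBall_const_eq_zero (hn : n - 1 < n) {s : SignedMeasure (E n)}
    {U : Set (E n)} (hU : IsOpen U) (hne : U.Nonempty) {c : ℝ}
    (h : ∀ x ∈ U, ∀ᶠ r in 𝓝[>] (0 : ℝ), s (Metric.closedBall x r) = r ^ (n - 1) * c) :
    c = 0 := by
  set p := s.toJordanDecomposition.posPart
  set q := s.toJordanDecomposition.negPart
  obtain ⟨x, hx, h1, h2, h3, h4⟩ : ∃ x ∈ U,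
      Tendsto (fun r => p (Metric.closedBall x r) / volume (Metric.closedBall x r)) (𝓝[>] 0)
        (𝓝 (p.rnDeriv volume x)) ∧
      Tendsto (fun r => q (Metric.closedBall x r) / volume (Metric.closedBall x r)) (𝓝[>] 0)
        (𝓝 (q.rnDeriv volume x)) ∧ p.rnDeriv volume x < ⊤ ∧ q.rnDeriv volume x < ⊤ := by
    have hae : ∀ᵐ x ∂(volume : Measure (E n)), _ :=
      ((Besicovitch.ae_tendsto_rnDeriv p volume).and
        (Besicovitch.ae_tendsto_rnDeriv q volume)).and
      ((p.rnDeriv_lt_top volume).and (q.rnDeriv_lt_top volume))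
    obtain ⟨x, hxU, hx⟩ := ((frequently_ae_mem_iff.2 (hU.measure_pos volume hne).ne').and_eventually
      hae).exists
    exact ⟨x, hxU, hx.1.1, hx.1.2, hx.2.1, hx.2.2⟩
  set κ := (volume (Metric.closedBall (0 : E n) 1)).toReal
  have hκ : 0 < κ := ENNReal.toReal_pos (Metric.measure_closedBall_pos volume _ one_pos).ne'
    measure_closedBall_lt_top.ne
  have h5 := ((ENNReal.tendsto_toReal h3.ne).comp h1).sub ((ENNReal.tendsto_toReal h4.ne).comp h2)
  have hid : Tendsto (fun r : ℝ => r) (𝓝[>] 0) (𝓝 0) := tendsto_id.mono_left nhdsWithin_le_nhds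
  -- The quotient by the volume behaves like `c / (κ r)`, which converges only if `c = 0`.
  have h6 := hid.mul h5
  rw [zero_mul] at h6
  have h7 : Tendsto (fun _ : ℝ => c / κ) (𝓝[>] 0) (𝓝 0) := by
    refine h6.congr' ?_
    filter_upwards [h x hx, self_mem_nhdsWithin] with r hr (hr0 : 0 < r)
    have hsub : s (Metric.closedBall x r)
        = (p (Metric.closedBall x r)).toReal - (q (Metric.closedBall x r)).toReal :=
      s.apply_eq_posPart_real_sub_negPart_real Metric.isClosed_closedBall.measurableSet
    have hv : (volume (Metric.closedBall x r)).toReal = r ^ n * κ := by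
      rw [Measure.addHaar_closedBall' _ _ hr0.le, ENNReal.toReal_mul,
        ENNReal.toReal_ofReal (by positivity), finrank_euclideanSpace_fin]
    simp only [Function.comp_apply]
    rw [ENNReal.toReal_div, ENNReal.toReal_div, ← sub_div, ← hsub, hr, hv]
    obtain ⟨k, rfl⟩ : ∃ k, n = k + 1 := ⟨n - 1, by omega⟩
    rw [Nat.add_sub_cancel]
    field_simp
    ring
  have := tendsto_nhds_unique h7 tendsto_const_nhds
  exact ((div_eq_zero_iff.1 this.symm).resolve_right hκ.ne')

/-- A complex measure on an open set whose value on small balls is `c r ^ (n - 1)` vanishes there: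
the exponent does not match the dimension. -/
theorem variation_eq_zero_of_closedBall_eq (hn : n - 1 < n) {μ : ComplexMeasure (E n)}
    {U : Set (E n)} (hU : IsOpen U) {c : ℂ}
    (h : ∀ x ∈ U, ∀ᶠ r in 𝓝[>] (0 : ℝ), μ (Metric.closedBall x r) = ((r ^ (n - 1) : ℝ) : ℂ) * c) :
    μ.variation U = 0 := by
  rcases U.eq_empty_or_nonempty with rfl | hne
  · exact measure_empty
  have hc : c = 0 := by
    refine Complex.ext ?_ ?_
    · refine signedMeasure_closedBall_const_eq_zero hn (s := ComplexMeasure.re μ) hU hne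
        fun x hx => (h x hx).mono fun r hr => ?_
      change (μ (Metric.closedBall x r)).re = _
      rw [hr, Complex.re_ofReal_mul]
    · refine signedMeasure_closedBall_const_eq_zero hn (s := ComplexMeasure.im μ) hU hne
        fun x hx => (h x hx).mono fun r hr => ?_
      change (μ (Metric.closedBall x r)).im = _
      rw [hr, Complex.im_ofReal_mul]
  refine variation_eq_zero_of_closedBall (ρ := 0) hU.measurableSet fun x hx => ⟨0, ?_⟩
  obtain ⟨ε, hε, hball⟩ := Metric.isOpen_iff.1 hU x hx
  filter_upwards [h x hx, Ioo_mem_nhdsGT hε] with r hr hrε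
  rw [Set.inter_eq_left.2 ((Metric.closedBall_subset_ball hrε.2).trans hball), hr, hc]
  simp

end Differentiation

/-! ### Vanishing of curvature measures on polyhedral pieces -/

section Polyhedral

variable {n : ℕ}

/-- The cone `{y | ⟪v, y⟫ ≤ 0 for v ∈ s}`, truncated at radius `2` to make it a convex body. -/
def coneBody (s : Set (Sph n)) : ConvexBody (E n) where
  carrier := {y | ∀ v ∈ s, ⟪(v : E n), y⟫ ≤ 0} ∩ Metric.closedBall 0 2
  convex' := by
    refine Convex.inter (fun y hy z hz a b ha hb _ v hv => ?_) (convex_closedBall 0 2)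
    rw [inner_add_right, inner_smul_right, inner_smul_right]
    exact add_nonpos (mul_nonpos_of_nonneg_of_nonpos ha (hy v hv))
      (mul_nonpos_of_nonneg_of_nonpos hb (hz v hv))
  isCompact' := by
    refine (isCompact_closedBall 0 2).inter_left ?_
    simp only [Set.ofPred_forall]
    exact isClosed_biInter fun v _ => isClosed_le (by fun_prop) continuous_const
  nonempty' := ⟨0, by simp, by simp⟩

/-- The unit ball in the lineality space of the cone of `coneBody s`. -/
def coneFace (s : Set (Sph n)) : Set (E n) :=
  {y | ∀ v ∈ s, ⟪(v : E n), y⟫ = 0} ∩ Metric.closedBall 0 1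

theorem mem_coneBody {s : Set (Sph n)} {y : E n} :
    y ∈ coneBody s ↔ (∀ v ∈ s, ⟪(v : E n), y⟫ ≤ 0) ∧ ‖y‖ ≤ 2 := by
  rw [← mem_closedBall_zero_iff]; rfl

theorem mem_coneFace {s : Set (Sph n)} {y : E n} :
    y ∈ coneFace s ↔ (∀ v ∈ s, ⟪(v : E n), y⟫ = 0) ∧ ‖y‖ ≤ 1 := by
  rw [← mem_closedBall_zero_iff]; rfl

theorem isClosed_coneFace (s : Set (Sph n)) : IsClosed (coneFace s) := by
  refine IsClosed.inter ?_ Metric.isClosed_closedBall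
  simp only [Set.ofPred_forall]
  exact isClosed_biInter fun v _ => isClosed_eq (by fun_prop) continuous_const

theorem mem_image_similarity_iff {r : ℝ} (hr : 0 < r) {x y : E n} {A : Set (E n)} :
    y ∈ (fun z => r • z + x) '' A ↔ r⁻¹ • (y - x) ∈ A := by
  constructor
  · rintro ⟨z, hz, rfl⟩
    simpa [smul_smul, hr.ne'] using hz
  · intro h
    exact ⟨_, h, by simp [smul_smul, hr.ne']⟩

theorem image_similarity_closedBall {r : ℝ} (hr : 0 < r) (x : E n) :
    (fun z => r • z + x) '' Metric.closedBall 0 1 = Metric.closedBall x r := by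
  ext y
  rw [mem_image_similarity_iff hr, mem_closedBall_zero_iff, mem_closedBall_iff_norm, norm_smul,
    norm_inv, Real.norm_of_nonneg hr.le, inv_mul_le_iff₀ hr, mul_one]

theorem eventually_ball_subset {U : Set (E n)} (hU : IsOpen U) {x : E n} (hx : x ∈ U) :
    ∀ᶠ r in 𝓝[>] (0 : ℝ), Metric.ball x (3 / 2 * r) ⊆ U := by
  obtain ⟨ε, hε, h⟩ := Metric.isOpen_iff.1 hU x hx
  filter_upwards [Ioo_mem_nhdsGT (show 0 < ε / 2 by positivity)] with r hr
  exact (Metric.ball_subset_ball (by linarith [hr.2])).trans h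

variable {Δ : ConvexBody (E n) → ComplexMeasure (E n)}

/-- If `K` agrees near `x` with the scaled copy `r M + x`, then `Δ K` is determined near `x` by
`Δ M`. -/
theorem curv_apply_of_local_eq (hn : n - 1 < n) (hΔ : Δ ∈ Curv n ((n : ℝ) - 1))
    {K M : ConvexBody (E n)} {x : E n} {r : ℝ} (hr : 0 < r)
    (h : (K : Set (E n)) ∩ Metric.ball x (3 / 2 * r)
      = (fun z => r • z + x) '' (M : Set (E n)) ∩ Metric.ball x (3 / 2 * r))
    {β : Set (E n)} (hβ : MeasurableSet β) (hβ1 : β ⊆ Metric.closedBall 0 1) :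
    Δ K ((fun z => r • z + x) '' β) = ((r ^ (n - 1) : ℝ) : ℂ) * Δ M β := by
  have himg : ∀ A : Set (E n), (fun z => r • z + x) '' A = (fun y => y + x) '' (r • A) := by
    intro A
    rw [← Set.image_smul, Set.image_image]
  have hβr : MeasurableSet (r • β) := hβ.const_smul₀ r
  have hβx : MeasurableSet ((fun z => r • z + x) '' β) := by
    rw [himg]
    exact (measurableEmbedding_addRight x).measurableSet_image.2 hβr
  have hsub : (fun z => r • z + x) '' β ⊆ Metric.ball x (3 / 2 * r) := by
    refine (Set.image_mono hβ1).trans ?_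
    rw [image_similarity_closedBall hr]
    exact Metric.closedBall_subset_ball (by linarith)
  rw [hΔ.1.locality K (translate (r • M) x) _ Metric.isOpen_ball
    (by rw [h, himg]; rfl) _ hβx hsub, himg, hΔ.1.translation_invariance _ _ hβr,
    hΔ.2 M β hβ r hr]
  congr 2
  rw [← Real.rpow_natCast, Nat.cast_sub (by omega), Nat.cast_one]

/-- A curvature measure of degree `n - 1` vanishes on an open set in which small balls of the body
all look like one model: the mass of such balls is `r ^ (n - 1)` times a constant. -/
theorem curv_variation_eq_zero_of_isOpen (hn : n - 1 < n) (hΔ : Δ ∈ Curv n ((n : ℝ) - 1))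
    {K : ConvexBody (E n)} (M : ConvexBody (E n)) {U : Set (E n)} (hU : IsOpen U)
    (h : ∀ x ∈ U, ∀ᶠ r in 𝓝[>] (0 : ℝ), (K : Set (E n)) ∩ Metric.ball x (3 / 2 * r)
      = (fun z => r • z + x) '' (M : Set (E n)) ∩ Metric.ball x (3 / 2 * r)) :
    (Δ K).variation U = 0 := by
  refine variation_eq_zero_of_closedBall_eq hn hU (c := Δ M (Metric.closedBall 0 1))
    fun x hx => ?_
  filter_upwards [h x hx, self_mem_nhdsWithin] with r hr (hr0 : 0 < r)
  rw [← image_similarity_closedBall hr0]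
  exact curv_apply_of_local_eq hn hΔ hr0 hr Metric.isClosed_closedBall.measurableSet le_rfl

/-- A curvature measure of degree `n - 1` has no mass outside the body. -/
theorem curv_variation_eq_zero_of_disjoint [Nonempty (Sph n)] (hn : n - 1 < n)
    (hΔ : Δ ∈ Curv n ((n : ℝ) - 1)) {K : ConvexBody (E n)} {U : Set (E n)} (hU : IsOpen U)
    (hKU : Disjoint (K : Set (E n)) U) : (Δ K).variation U = 0 := by
  obtain ⟨e⟩ := ‹Nonempty (Sph n)›
  -- The model body is a point outside the ball of radius `3 / 2`.
  refine curv_variation_eq_zero_of_isOpen hn hΔ (K := K)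
    ⟨{(2 : ℝ) • (e : E n)}, convex_singleton _, isCompact_singleton, Set.singleton_nonempty _⟩ hU
    fun x hx => ?_
  filter_upwards [eventually_ball_subset hU hx, self_mem_nhdsWithin] with r hr (hr0 : 0 < r)
  rw [(hKU.mono_right hr).inter_eq, eq_comm, ← Set.disjoint_iff_inter_eq_empty,
    ConvexBody.coe_mk, Set.image_singleton, Set.disjoint_singleton_left, mem_ball_iff_norm,
    add_sub_cancel_right, norm_smul, norm_smul, norm_coe_sph, Real.norm_of_nonneg hr0.le]
  norm_num
  linarith

variable {ι : Type*} [Finite ι]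

/-- The points of `V` at which exactly the constraints `⟪v i, x⟫ ≤ h i` with `i ∈ I` are active. -/
def stratum (V : Set (E n)) (v : ι → Sph n) (h : ι → ℝ) (I : Set ι) : Set (E n) :=
  {x | x ∈ V ∧ ∀ i, (i ∈ I → ⟪(v i : E n), x⟫ = h i) ∧ (i ∉ I → ⟪(v i : E n), x⟫ < h i)}

theorem measurableSet_stratum {V : Set (E n)} (hV : IsOpen V) (v : ι → Sph n) (h : ι → ℝ)
    (I : Set ι) : MeasurableSet (stratum V v h I) := by
  have : stratum V v h I = V ∩ ((⋂ i ∈ I, {x | ⟪(v i : E n), x⟫ = h i}) ∩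
      ⋂ i ∈ Iᶜ, {x | ⟪(v i : E n), x⟫ < h i}) := by
    ext x
    simp [stratum, forall_and]
    tauto
  rw [this]
  refine hV.measurableSet.inter (MeasurableSet.inter ?_ ?_)
  · exact (isClosed_biInter fun i _ =>
      isClosed_eq (by fun_prop) continuous_const).measurableSet
  · exact ((Set.toFinite _).isOpen_biInter fun i _ =>
      isOpen_lt (by fun_prop) continuous_const).measurableSet

variable {K : ConvexBody (E n)} {V : Set (E n)} {v : ι → Sph n} {h : ι → ℝ} {I : Set ι}

/-- Near a point of a stratum, the body is a translate of the corresponding cone. -/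
theorem eventually_inter_ball_eq (hV : IsOpen V)
    (hK : (K : Set (E n)) ∩ V = {x | ∀ i, ⟪(v i : E n), x⟫ ≤ h i} ∩ V) {x : E n}
    (hx : x ∈ stratum V v h I) : ∀ᶠ r in 𝓝[>] (0 : ℝ),
      (K : Set (E n)) ∩ Metric.ball x (3 / 2 * r)
        = (fun z => r • z + x) '' (coneBody (v '' I) : Set (E n)) ∩ Metric.ball x (3 / 2 * r) ∧
      Metric.closedBall x r ∩ stratum V v h I = (fun z => r • z + x) '' coneFace (v '' I) := by
  have hW : IsOpen (V ∩ ⋂ i ∈ Iᶜ, {x | ⟪(v i : E n), x⟫ < h i}) :=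
    hV.inter ((Set.toFinite _).isOpen_biInter fun i _ =>
      isOpen_lt (by fun_prop) continuous_const)
  have hxW : x ∈ V ∩ ⋂ i ∈ Iᶜ, {x | ⟪(v i : E n), x⟫ < h i} :=
    ⟨hx.1, Set.mem_iInter₂.2 fun i hi => (hx.2 i).2 hi⟩
  filter_upwards [eventually_ball_subset hW hxW, self_mem_nhdsWithin] with r hr (hr0 : 0 < r)
  have hVr : ∀ y ∈ Metric.ball x (3 / 2 * r), y ∈ V := fun y hy => (hr hy).1
  have hIr : ∀ y ∈ Metric.ball x (3 / 2 * r), ∀ i ∉ I, ⟪(v i : E n), y⟫ < h i := fun y hy i hi =>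
    Set.mem_iInter₂.1 (hr hy).2 i hi
  have hinner : ∀ y, ∀ i ∈ I, ⟪(v i : E n), r⁻¹ • (y - x)⟫ = r⁻¹ * (⟪(v i : E n), y⟫ - h i) :=
    fun y i hi => by rw [inner_smul_right, inner_sub_right, (hx.2 i).1 hi]
  have hrinv : 0 < r⁻¹ := inv_pos.2 hr0
  constructor
  · ext y
    refine and_congr_left fun hy => ?_
    have hKy : y ∈ (K : Set (E n)) ↔ ∀ i, ⟪(v i : E n), y⟫ ≤ h i := by
      have := Set.ext_iff.1 hK y
      simpa [hVr y hy] using this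
    have hnorm : ‖r⁻¹ • (y - x)‖ ≤ 2 := by
      rw [norm_smul, norm_inv, Real.norm_of_nonneg hr0.le, inv_mul_le_iff₀ hr0]
      have := mem_ball_iff_norm.1 hy
      linarith
    rw [mem_image_similarity_iff hr0, hKy, SetLike.mem_coe, mem_coneBody, Set.forall_mem_image]
    constructor
    · intro hle
      exact ⟨fun i hi => by
        rw [hinner y i hi]
        exact mul_nonpos_of_nonneg_of_nonpos hrinv.le (sub_nonpos.2 (hle i)), hnorm⟩
    · rintro ⟨hle, -⟩ i
      by_cases hi : i ∈ I
      · have := hle hi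
        rw [hinner y i hi] at this
        exact sub_nonpos.1 (nonpos_of_mul_nonpos_right this hrinv)
      · exact (hIr y hy i hi).le
  · ext y
    rw [Set.mem_inter_iff, mem_image_similarity_iff hr0, mem_coneFace, Set.forall_mem_image,
      norm_smul, norm_inv, Real.norm_of_nonneg hr0.le, inv_mul_le_iff₀ hr0, mul_one,
      ← mem_closedBall_iff_norm, and_comm]
    refine and_congr_left_iff.2 fun hy => ?_
    have hyb : y ∈ Metric.ball x (3 / 2 * r) :=
      Metric.closedBall_subset_ball (by linarith) hy
    constructor
    · intro hs i hi
      rw [hinner y i hi, (hs.2 i).1 hi, sub_self, mul_zero]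
    · intro hs
      refine ⟨hVr y hyb, fun i => ⟨fun hi => ?_, hIr y hyb i⟩⟩
      have := hs hi
      rw [hinner y i hi] at this
      exact sub_eq_zero.1 ((mul_eq_zero.1 this).resolve_left hrinv.ne')

omit [Finite ι] in
theorem stratum_subset (hK : (K : Set (E n)) ∩ V = {x | ∀ i, ⟪(v i : E n), x⟫ ≤ h i} ∩ V) :
    stratum V v h I ⊆ (K : Set (E n)) := fun x hx => by
  have : x ∈ {x | ∀ i, ⟪(v i : E n), x⟫ ≤ h i} ∩ V := ⟨fun i => by
    by_cases hi : i ∈ I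
    · exact ((hx.2 i).1 hi).le
    · exact ((hx.2 i).2 hi).le, hx.1⟩
  exact (hK ▸ this : x ∈ (K : Set (E n)) ∩ V).1

theorem eventually_curv_apply_stratum (hn : n - 1 < n) (hΔ : Δ ∈ Curv n ((n : ℝ) - 1))
    (hV : IsOpen V) (hK : (K : Set (E n)) ∩ V = {x | ∀ i, ⟪(v i : E n), x⟫ ≤ h i} ∩ V) {x : E n}
    (hx : x ∈ stratum V v h I) : ∀ᶠ r in 𝓝[>] (0 : ℝ),
      Δ K (Metric.closedBall x r ∩ stratum V v h I)
        = ((r ^ (n - 1) : ℝ) : ℂ) * Δ (coneBody (v '' I)) (coneFace (v '' I)) := by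
  filter_upwards [eventually_inter_ball_eq hV hK hx, self_mem_nhdsWithin] with r hr (hr0 : 0 < r)
  rw [hr.2]
  exact curv_apply_of_local_eq hn hΔ hr0 hr.1 (isClosed_coneFace _).measurableSet
    Set.inter_subset_right

theorem finrank_span_pair_of_ne {u w : Sph n} (h1 : u ≠ w) (h2 : (w : E n) ≠ -u) :
    Module.finrank ℝ (Submodule.span ℝ {(u : E n), (w : E n)}) = 2 := by
  have hu : (u : E n) ≠ 0 := fun h0 => by
    have := norm_coe_sph u
    rw [h0, norm_zero] at this
    exact zero_ne_one this
  have hli : LinearIndependent ℝ ![(u : E n), (w : E n)] := by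
    rw [LinearIndependent.pair_iff' hu]
    intro a ha
    have hn := congrArg norm ha
    rw [norm_smul, norm_coe_sph, norm_coe_sph, mul_one, Real.norm_eq_abs] at hn
    rcases eq_or_eq_neg_of_abs_eq hn with rfl | rfl
    · exact h1 (Subtype.ext (by rw [← ha, one_smul]))
    · exact h2 (by rw [← ha, neg_smul, one_smul])
  have := finrank_span_eq_card hli
  rwa [Matrix.range_cons, Matrix.range_cons, Matrix.range_empty, Set.union_empty,
    Fintype.card_fin] at this

/-- The strata of codimension at least two carry no mass: they lie in an affine subspace of
dimension `n - 2`, whereas the mass of a ball of radius `r` is proportional to `r ^ (n - 1)`. -/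
theorem curv_variation_stratum_of_nontrivial (hn : n - 1 < n) (hΔ : Δ ∈ Curv n ((n : ℝ) - 1))
    (hV : IsOpen V) (hK : (K : Set (E n)) ∩ V = {x | ∀ i, ⟪(v i : E n), x⟫ ≤ h i} ∩ V)
    {z : E n} (hz : ∀ i, ⟪(v i : E n), z⟫ < h i) {i j : ι} (hi : i ∈ I) (hj : j ∈ I)
    (hij : v i ≠ v j) : (Δ K).variation (stratum V v h I) = 0 := by
  rcases (stratum V v h I).eq_empty_or_nonempty with he | ⟨x₀, hx₀⟩
  · rw [he, measure_empty]
  have hne : (v j : E n) ≠ -v i := by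
    intro hji
    have h1 := hz i
    have h2 := hz j
    rw [← (hx₀.2 i).1 hi] at h1
    rw [← (hx₀.2 j).1 hj, hji, inner_neg_left, inner_neg_left] at h2
    linarith
  set P := (Submodule.span ℝ {(v i : E n), (v j : E n)})ᗮ
  have hP : Module.finrank ℝ P + 2 = n := by
    have := Submodule.finrank_add_finrank_orthogonal
      (Submodule.span ℝ {(v i : E n), (v j : E n)})
    rw [finrank_span_pair_of_ne hij hne, finrank_euclideanSpace_fin] at this
    rwa [add_comm]
  obtain ⟨R, hR⟩ := K.isBounded.subset_closedBall x₀
  have hmeas : Measurable fun y : P => (y : E n) + x₀ := by fun_prop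
  set ρ : Measure (E n) := ((volume : Measure P).restrict (Metric.closedBall 0 (R + 1))).map
    fun y : P => (y : E n) + x₀
  have hfin : IsFiniteMeasure ((volume : Measure P).restrict (Metric.closedBall 0 (R + 1))) :=
    ⟨by rw [Measure.restrict_apply_univ]; exact measure_closedBall_lt_top⟩
  set κ := (volume (Metric.closedBall (0 : P) 1)).toReal
  have hκ : 0 < κ := ENNReal.toReal_pos (Metric.measure_closedBall_pos volume _ one_pos).ne'
    measure_closedBall_lt_top.ne
  set c := Δ (coneBody (v '' I)) (coneFace (v '' I))
  refine variation_eq_zero_of_closedBall (ρ := ρ) (measurableSet_stratum hV v h I)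
    fun x hx => ⟨‖c‖ / κ, ?_⟩
  have hxP : x - x₀ ∈ P := by
    rw [Submodule.mem_orthogonal']
    intro w hw
    obtain ⟨a, b, rfl⟩ := Submodule.mem_span_pair.1 hw
    rw [real_inner_comm, inner_add_left, inner_smul_left, inner_smul_left, inner_sub_right,
      inner_sub_right, (hx.2 i).1 hi, (hx.2 j).1 hj, (hx₀.2 i).1 hi, (hx₀.2 j).1 hj]
    simp
  filter_upwards [eventually_curv_apply_stratum hn hΔ hV hK hx,
    Ioo_mem_nhdsGT (zero_lt_one (α := ℝ))] with r hr hr01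
  have hball : ρ (Metric.closedBall x r)
      = volume (Metric.closedBall (⟨x - x₀, hxP⟩ : P) r) := by
    rw [Measure.map_apply hmeas Metric.isClosed_closedBall.measurableSet, Measure.restrict_apply
      (hmeas Metric.isClosed_closedBall.measurableSet)]
    congr 1
    ext y
    have hd : dist ((y : E n) + x₀) x = dist y ⟨x - x₀, hxP⟩ := by
      rw [Subtype.dist_eq, dist_eq_norm, dist_eq_norm]
      congr 1
      simp only
      abel
    simp only [Set.mem_inter_iff, Set.mem_preimage, Metric.mem_closedBall, hd, and_iff_left_iff_imp]
    intro hy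
    have hx0 : dist (⟨x - x₀, hxP⟩ : P) 0 ≤ R := by
      rw [Subtype.dist_eq, dist_eq_norm]
      simpa [dist_eq_norm] using hR (stratum_subset hK hx)
    exact (dist_triangle _ _ _).trans (by linarith [hr01.2])
  rw [hball, Measure.addHaar_closedBall' _ _ hr01.1.le, ENNReal.toReal_mul,
    ENNReal.toReal_ofReal (pow_nonneg hr01.1.le _), hr, norm_mul, Complex.norm_real,
    Real.norm_of_nonneg (pow_nonneg hr01.1.le _)]
  have hpow : r ^ (n - 1) = r * r ^ Module.finrank ℝ P := by
    rw [← pow_succ']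
    congr 1
    omega
  rw [hpow]
  refine le_of_eq ?_
  change r * r ^ _ * ‖c‖ = ‖c‖ / κ * r * (r ^ _ * κ)
  field_simp

/-- A curvature measure of degree `n - 1` vanishes on every open set in which the body is a
polyhedron, if it vanishes on the facets of the corresponding half balls. -/
theorem curv_variation_eq_zero_of_polyhedral [Nonempty (Sph n)] (hn : n - 1 < n)
    (hΔ : Δ ∈ Curv n ((n : ℝ) - 1)) (hV : IsOpen V)
    (hK : (K : Set (E n)) ∩ V = {x | ∀ i, ⟪(v i : E n), x⟫ ≤ h i} ∩ V)
    {z : E n} (hz : ∀ i, ⟪(v i : E n), z⟫ < h i)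
    (hface : ∀ i, Δ (coneBody {v i}) (coneFace {v i}) = 0) : (Δ K).variation V = 0 := by
  have hext : (Δ K).variation (V ∩ (K : Set (E n))ᶜ) = 0 :=
    curv_variation_eq_zero_of_disjoint hn hΔ (hV.inter K.isClosed.isOpen_compl)
      (Set.disjoint_left.2 fun x hx hx' => hx'.2 hx)
  have hstr : ∀ I : Set ι, (Δ K).variation (stratum V v h I) = 0 := by
    intro I
    rcases I.eq_empty_or_nonempty with rfl | ⟨i, hi⟩
    · have hopen : IsOpen (stratum V v h ∅) := by
        have : stratum V v h ∅ = V ∩ ⋂ i, {x | ⟪(v i : E n), x⟫ < h i} := by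
          ext x; simp [stratum]
        rw [this]
        exact hV.inter (isOpen_iInter_of_finite fun i =>
          isOpen_lt (by fun_prop) continuous_const)
      exact curv_variation_eq_zero_of_isOpen hn hΔ (coneBody (v '' ∅)) hopen fun x hx =>
        (eventually_inter_ball_eq hV hK hx).mono fun r hr => hr.1
    · by_cases hall : ∀ j ∈ I, v j = v i
      · have himg : v '' I = {v i} :=
          Set.eq_singleton_iff_unique_mem.2 ⟨⟨i, hi, rfl⟩, by rintro _ ⟨j, hj, rfl⟩; exact hall j hj⟩
        refine variation_eq_zero_of_closedBall (ρ := 0) (measurableSet_stratum hV v h I)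
          fun x hx => ⟨0, ?_⟩
        filter_upwards [eventually_curv_apply_stratum hn hΔ hV hK hx] with r hr
        rw [hr, himg, hface i]
        simp
      · push Not at hall
        obtain ⟨j, hj, hji⟩ := hall
        exact curv_variation_stratum_of_nontrivial hn hΔ hV hK hz hj hi hji
  have : Finite (Set ι) := inferInstance
  refine measure_mono_null (fun x hx => ?_) (measure_union_null hext (measure_iUnion_null hstr))
  by_cases hxK : x ∈ K
  · right
    have hle : ∀ i, ⟪(v i : E n), x⟫ ≤ h i :=
      (hK ▸ ⟨hxK, hx⟩ : x ∈ {x | ∀ i, ⟪(v i : E n), x⟫ ≤ h i} ∩ V).1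
    exact Set.mem_iUnion.2 ⟨{i | ⟪(v i : E n), x⟫ = h i}, hx, fun i =>
      ⟨fun hi => hi, fun hi => lt_of_le_of_ne (hle i) hi⟩⟩
  · exact Or.inl ⟨hx, hxK⟩

end Polyhedral

/-! ### Approximation by polytopes -/

section Approximation

variable {n : ℕ} [Nonempty (Sph n)]

/-- A convex body is approximated from outside by polytopes containing it strictly: the points at
distance exactly `ε` are cut off by finitely many half spaces orthogonal to the directions of
projection. -/
theorem exists_polytope_dist_le (K : ConvexBody (E n)) {ε : ℝ} (hε : 0 < ε) :
    ∃ (t : Finset (E n)) (v : t → Sph n) (h : t → ℝ) (P : ConvexBody (E n)),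
      (P : Set (E n)) = {x | ∀ i, ⟪(v i : E n), x⟫ ≤ h i} ∧
      (∃ z, ∀ i, ⟪(v i : E n), z⟫ < h i) ∧ dist P K ≤ ε := by
  set A : Set (E n) := {y | ‖y - proj K y‖ = ε}
  have hcont := continuous_proj K
  have hA : IsCompact A := by
    obtain ⟨R, hR⟩ := K.isBounded.subset_closedBall 0
    refine Metric.isCompact_of_isClosed_isBounded (isClosed_eq (by fun_prop) continuous_const)
      ((Metric.isBounded_closedBall (x := (0 : E n)) (r := R + ε)).subset
        fun y (hy : ‖y - proj K y‖ = ε) => ?_)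
    have h1 := mem_closedBall_zero_iff.1 (hR (proj_mem K y))
    have h2 := norm_add_le (proj K y) (y - proj K y)
    rw [add_sub_cancel] at h2
    rw [mem_closedBall_zero_iff]
    linarith
  have hAK : ∀ y ∈ A, y ∉ K := fun y (hy : ‖y - proj K y‖ = ε) hyK => by
    rw [proj_of_mem hyK, sub_self, norm_zero] at hy
    exact hε.ne hy
  obtain ⟨t, htA, ht⟩ := hA.elim_nhds_subcover
    (fun w => {y | ⟪(normalDir K w : E n), proj K w⟫ + ε / 2 < ⟪(normalDir K w : E n), y⟫})
    fun w hw => by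
      refine (isOpen_lt continuous_const (by fun_prop)).mem_nhds ?_
      have h1 : ⟪(normalDir K w : E n), w - proj K w⟫ = ε := by
        rw [← norm_smul_normalDir (hAK w hw), hw, inner_smul_right, real_inner_self_eq_norm_sq,
          norm_coe_sph, one_pow, mul_one]
      rw [inner_sub_right] at h1
      change ⟪(normalDir K w : E n), proj K w⟫ + ε / 2 < ⟪(normalDir K w : E n), w⟫
      linarith
  have hK : ∀ x ∈ K, ∀ w ∈ t,
      ⟪(normalDir K w : E n), x⟫ < ⟪(normalDir K w : E n), proj K w⟫ + ε / 2 := by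
    intro x hx w hw
    have := (gaussPair_mem_normalCycle (hAK w (htA w hw))).2 x hx
    change ⟪(normalDir K w : E n), x - proj K w⟫ ≤ 0 at this
    rw [inner_sub_right] at this
    linarith
  set Q : Set (E n) := {x | ∀ i : t, ⟪(normalDir K i : E n), x⟫
    ≤ ⟪(normalDir K i : E n), proj K i⟫ + ε / 2}
  have hKQ : (K : Set (E n)) ⊆ Q := fun x hx i => (hK x hx i i.2).le
  have hQconv : Convex ℝ Q := by
    have : Q = ⋂ i : t, {x | ⟪(normalDir K i : E n), x⟫
        ≤ ⟪(normalDir K i : E n), proj K i⟫ + ε / 2} := Set.ofPred_forall _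
    rw [this]
    exact convex_iInter fun i => convex_halfSpace_le (innerSL ℝ (normalDir K i : E n)).isLinear _
  have hQclosed : IsClosed Q := by
    have : Q = ⋂ i : t, {x | ⟪(normalDir K i : E n), x⟫
        ≤ ⟪(normalDir K i : E n), proj K i⟫ + ε / 2} := Set.ofPred_forall _
    rw [this]
    exact isClosed_iInter fun i => isClosed_le (by fun_prop) continuous_const
  have hQ : ∀ y ∈ Q, ‖y - proj K y‖ ≤ ε := by
    intro y hy
    by_contra! hlt
    -- Otherwise the segment from `y` to its projection, which lies in `Q`, meets `A`.
    have h0 : 0 < ‖y - proj K y‖ := hε.trans hlt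
    have hs0 : 0 ≤ ε / ‖y - proj K y‖ := by positivity
    have hs1 : ε / ‖y - proj K y‖ ≤ 1 := (div_le_one h0).2 hlt.le
    have hmem : radial K (ε / ‖y - proj K y‖) y ∈ A := by
      change ‖_‖ = ε
      rw [radial_sub_proj K y hs0, norm_smul, Real.norm_of_nonneg hs0, div_mul_cancel₀ _ h0.ne']
    have hmemQ : radial K (ε / ‖y - proj K y‖) y ∈ Q :=
      hQconv.add_smul_sub_mem (hKQ (proj_mem K y)) hy ⟨hs0, hs1⟩
    obtain ⟨w, hw, hlt'⟩ := Set.mem_iUnion₂.1 (ht hmem)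
    exact (hmemQ ⟨w, hw⟩).not_gt hlt'
  have hQbdd : Bornology.IsBounded Q := by
    obtain ⟨R, hR⟩ := K.isBounded.subset_closedBall 0
    refine (Metric.isBounded_closedBall (x := (0 : E n)) (r := R + ε)).subset fun y hy => ?_
    have h1 := mem_closedBall_zero_iff.1 (hR (proj_mem K y))
    have h2 := norm_add_le (proj K y) (y - proj K y)
    have h3 := hQ y hy
    rw [add_sub_cancel] at h2
    rw [mem_closedBall_zero_iff]
    linarith
  obtain ⟨z, hz⟩ := K.nonempty
  refine ⟨t, fun i => normalDir K i, fun i => ⟪(normalDir K i : E n), proj K i⟫ + ε / 2,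
    ⟨Q, hQconv, Metric.isCompact_of_isClosed_isBounded hQclosed hQbdd, z, hKQ hz⟩, rfl,
    ⟨z, fun i => hK z hz i i.2⟩, ?_⟩
  rw [← ConvexBody.hausdorffDist_coe]
  refine Metric.hausdorffDist_le_of_mem_dist hε.le (fun y hy => ⟨proj K y, proj_mem K y, ?_⟩)
    fun x hx => ⟨x, hKQ hx, by rw [dist_self]; exact hε.le⟩
  rw [dist_eq_norm]
  exact hQ y hy

/-- A curvature measure of degree `n - 1` is determined by its values on the facets of the half
balls of radius `2`. -/
theorem curv_eq_zero_of_facet_eq_zero (hn : n - 1 < n)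
    {Δ : ConvexBody (E n) → ComplexMeasure (E n)} (hΔ : Δ ∈ Curv n ((n : ℝ) - 1))
    (hface : ∀ u : Sph n, Δ (coneBody {u}) (coneFace {u}) = 0) (K : ConvexBody (E n)) :
    Δ K = 0 := by
  have hpos : ∀ j : ℕ, (0 : ℝ) < 1 / (j + 1) := fun j => by positivity
  choose t v h P hP hz hdist using fun j : ℕ => exists_polytope_dist_le K (hpos j)
  have hzero : ∀ j, Δ (P j) = 0 := fun j => by
    obtain ⟨z, hz⟩ := hz j
    have hvar := curv_variation_eq_zero_of_polyhedral hn hΔ isOpen_univ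
      (by rw [hP j]) hz fun i => hface (v j i)
    exact VectorMeasure.variation_eq_zero.1 (Measure.measure_univ_eq_zero.1 hvar)
  have hlim : Tendsto P atTop (𝓝 K) := tendsto_iff_dist_tendsto_zero.2
    (squeeze_zero (fun _ => dist_nonneg) hdist tendsto_one_div_add_atTop_nhds_zero_nat)
  refine ext_of_forall_integral_eq fun g => ?_
  refine tendsto_nhds_unique (hΔ.1.continuity P K hlim g) ?_
  simp_rw [hzero]
  exact tendsto_const_nhds

end Approximation

/-! ### Support measures of half balls -/

section HalfBall

variable {n : ℕ}

theorem exists_mem_coneBody_singleton_norm_sub_le (u w : Sph n) {x : E n} (hx : x ∈ coneBody {u}) :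
    ∃ y ∈ coneBody {w}, ‖x - y‖ ≤ 2 * ‖(w : E n) - u‖ := by
  simp only [mem_coneBody, Set.mem_singleton_iff, forall_eq] at hx ⊢
  set m := max ⟪(w : E n), x⟫ 0
  have hm0 : 0 ≤ m := le_max_right _ _
  have hmt : m * ⟪(w : E n), x⟫ = m ^ 2 := by
    rcases le_total ⟪(w : E n), x⟫ 0 with h | h
    · simp [m, max_eq_right h]
    · simp [m, max_eq_left h, sq]
  refine ⟨x - m • (w : E n), ⟨?_, ?_⟩, ?_⟩
  · rw [inner_sub_right, inner_smul_right, real_inner_self_eq_norm_sq, norm_coe_sph, one_pow,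
      mul_one]
    exact sub_nonpos.2 (le_max_left _ _)
  · refine le_trans (abs_le_of_sq_le_sq' ?_ (norm_nonneg x)).2 hx.2
    rw [norm_sub_sq_real, inner_smul_right, real_inner_comm, hmt, norm_smul, norm_coe_sph,
      Real.norm_of_nonneg hm0]
    nlinarith
  · rw [sub_sub_cancel, norm_smul, norm_coe_sph, Real.norm_of_nonneg hm0, mul_one]
    refine max_le ?_ (by positivity)
    have h1 : ⟪(w : E n), x⟫ = ⟪(w : E n) - u, x⟫ + ⟪(u : E n), x⟫ := by
      rw [inner_sub_left, sub_add_cancel]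
    have h2 := real_inner_le_norm ((w : E n) - u) x
    have h3 : ‖(w : E n) - u‖ * ‖x‖ ≤ ‖(w : E n) - u‖ * 2 :=
      mul_le_mul_of_nonneg_left hx.2 (norm_nonneg _)
    linarith [hx.1]

theorem continuous_coneBody_singleton : Continuous fun u : Sph n => coneBody {u} := by
  refine (LipschitzWith.of_dist_le_mul (K := 2) fun u w => ?_).continuous
  rw [← ConvexBody.hausdorffDist_coe, Subtype.dist_eq, dist_eq_norm]
  refine Metric.hausdorffDist_le_of_mem_dist (by positivity) (fun x hx => ?_) fun x hx => ?_
  · obtain ⟨y, hy, h⟩ := exists_mem_coneBody_singleton_norm_sub_le u w hx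
    exact ⟨y, hy, by rw [dist_eq_norm, norm_sub_rev (u : E n)]; exact h⟩
  · obtain ⟨y, hy, h⟩ := exists_mem_coneBody_singleton_norm_sub_le w u hx
    exact ⟨y, hy, by rw [dist_eq_norm]; exact h⟩

/-- Over the facet, the only outer unit normal of the half ball is `u`. -/
theorem eq_of_mem_normalCycle_coneBody {u : Sph n} {p : E n × Sph n}
    (hp : p ∈ normalCycle (coneBody {u})) (hx : p.1 ∈ coneFace {u}) : p.2 = u := by
  simp only [mem_coneFace, Set.mem_singleton_iff, forall_eq] at hx
  have hc : ⟪(p.2 : E n), (u : E n)⟫ ≤ 1 := by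
    simpa using real_inner_le_norm (p.2 : E n) (u : E n)
  have hnorm : ‖(2⁻¹ : ℝ) • ((p.2 : E n) - u)‖ ≤ 1 := by
    have := norm_sub_le (p.2 : E n) (u : E n)
    rw [norm_coe_sph, norm_coe_sph] at this
    rw [norm_smul, norm_inv, Real.norm_ofNat]
    linarith
  -- The point `x + (w - u) / 2` of the half ball shows that the normal `w` at `x` is `u`.
  have h := hp.2 (p.1 + (2⁻¹ : ℝ) • ((p.2 : E n) - u)) (by
    simp only [mem_coneBody, Set.mem_singleton_iff, forall_eq]
    refine ⟨?_, (norm_add_le _ _).trans (by linarith [hx.2])⟩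
    rw [inner_add_right, hx.1, inner_smul_right, inner_sub_right, real_inner_self_eq_norm_sq,
      norm_coe_sph, real_inner_comm]
    linarith)
  rw [add_sub_cancel_left, inner_smul_right, inner_sub_right, real_inner_self_eq_norm_sq,
    norm_coe_sph] at h
  exact Subtype.ext ((inner_eq_one_iff_of_norm_eq_one (𝕜 := ℝ) (norm_coe_sph _)
    (norm_coe_sph _)).1 (by linarith))

theorem mem_normalCycle_coneBody {u : Sph n} {x : E n} (hx : x ∈ coneFace {u}) :
    (x, u) ∈ normalCycle (coneBody {u}) := by
  simp only [mem_coneFace, Set.mem_singleton_iff, forall_eq] at hx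
  refine ⟨?_, fun y hy => ?_⟩
  · simp only [mem_coneBody, Set.mem_singleton_iff, forall_eq]
    exact ⟨hx.1.le, hx.2.trans one_le_two⟩
  · simp only [mem_coneBody, Set.mem_singleton_iff, forall_eq] at hy
    rw [inner_sub_right, hx.1, sub_zero]
    exact hy.1

theorem mem_localParallelSet_coneBody {u : Sph n} {ε : ℝ} {y : E n} :
    y ∈ localParallelSet (coneBody {u}) ε (Prod.fst ⁻¹' coneFace {u}) ↔
      ∃ x ∈ coneFace {u}, ∃ s ∈ Set.Ioc 0 ε, y = x + s • (u : E n) := by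
  constructor
  · rintro ⟨p, ⟨hp, hx⟩, s, hs, rfl⟩
    exact ⟨p.1, hx, s, hs, by rw [eq_of_mem_normalCycle_coneBody hp hx]⟩
  · rintro ⟨x, hx, s, hs, rfl⟩
    exact ⟨(x, u), ⟨mem_normalCycle_coneBody hx, hx⟩, s, hs, rfl⟩

theorem volume_localParallelSet_coneBody_pos (u : Sph n) :
    0 < volume (localParallelSet (coneBody {u}) 1 (Prod.fst ⁻¹' coneFace {u})) := by
  set O : Set (E n) := {y | 0 < ⟪(u : E n), y⟫} ∩ ({y | ⟪(u : E n), y⟫ < 1} ∩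
    {y | ‖y - ⟪(u : E n), y⟫ • (u : E n)‖ < 1})
  have hO : IsOpen O := (isOpen_lt continuous_const (by fun_prop)).inter
    ((isOpen_lt (by fun_prop) continuous_const).inter
      (isOpen_lt (by fun_prop) continuous_const))
  have hinner : ⟪(u : E n), (2⁻¹ : ℝ) • (u : E n)⟫ = 2⁻¹ := by
    rw [inner_smul_right, real_inner_self_eq_norm_sq, norm_coe_sph, one_pow, mul_one]
  have hne : O.Nonempty := by
    refine ⟨(2⁻¹ : ℝ) • (u : E n), ?_, ?_, ?_⟩
    · change 0 < ⟪(u : E n), (2⁻¹ : ℝ) • (u : E n)⟫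
      rw [hinner]; norm_num
    · change ⟪(u : E n), (2⁻¹ : ℝ) • (u : E n)⟫ < 1
      rw [hinner]; norm_num
    · change ‖_ - ⟪(u : E n), (2⁻¹ : ℝ) • (u : E n)⟫ • (u : E n)‖ < 1
      rw [hinner, sub_self, norm_zero]; norm_num
  refine (hO.measure_pos volume hne).trans_le (measure_mono fun y hy => ?_)
  refine mem_localParallelSet_coneBody.2 ⟨y - ⟪(u : E n), y⟫ • (u : E n), ?_, _,
    ⟨hy.1, (show ⟪(u : E n), y⟫ < 1 from hy.2.1).le⟩, (sub_add_cancel _ _).symm⟩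
  simp only [mem_coneFace, Set.mem_singleton_iff, forall_eq]
  refine ⟨?_, (show ‖y - ⟪(u : E n), y⟫ • (u : E n)‖ < 1 from hy.2.2).le⟩
  rw [inner_sub_right, inner_smul_right, real_inner_self_eq_norm_sq, norm_coe_sph, one_pow,
    mul_one, sub_self]

/-- The local parallel set over the facet is a cylinder, so doubling its height at most doubles its
volume. -/
theorem volume_localParallelSet_coneBody_two_le (u : Sph n) :
    volume (localParallelSet (coneBody {u}) 2 (Prod.fst ⁻¹' coneFace {u}))
      ≤ 2 * volume (localParallelSet (coneBody {u}) 1 (Prod.fst ⁻¹' coneFace {u})) := by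
  set M := localParallelSet (coneBody {u}) 1 (Prod.fst ⁻¹' coneFace {u})
  have hsub : localParallelSet (coneBody {u}) 2 (Prod.fst ⁻¹' coneFace {u})
      ⊆ M ∪ (fun y => -(u : E n) + y) ⁻¹' M := by
    intro y hy
    obtain ⟨x, hx, s, hs, rfl⟩ := mem_localParallelSet_coneBody.1 hy
    rcases le_or_gt s 1 with h | h
    · exact Or.inl (mem_localParallelSet_coneBody.2 ⟨x, hx, s, ⟨hs.1, h⟩, rfl⟩)
    · exact Or.inr (mem_localParallelSet_coneBody.2 ⟨x, hx, s - 1,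
        ⟨by linarith, by linarith [hs.2]⟩, by module⟩)
  refine (measure_mono hsub).trans ((measure_union_le _ _).trans ?_)
  rw [measure_preimage_add, two_mul]

variable [Nonempty (Sph n)]

/-- The support measure of order `n - 1` charges the facet of a half ball: otherwise the local
parallel volumes over the facet would grow at least quadratically, while they are linear. -/
theorem supportMeasure_facet_ne_zero (hn : n - 1 < n) (u : Sph n) :
    supportMeasure (coneBody {u}) ⟨n - 1, hn⟩ (Prod.fst ⁻¹' coneFace {u}) ≠ 0 := by
  intro h0
  have hst := satisfiesLocalSteiner_supportMeasure (coneBody {u})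
  have hη : MeasurableSet (Prod.fst ⁻¹' coneFace {u} : Set (E n × Sph n)) :=
    measurable_fst (isClosed_coneFace _).measurableSet
  have h1 := hst.steiner 1 one_pos _ hη
  have h2 := hst.steiner 2 two_pos _ hη
  have hpos := volume_localParallelSet_coneBody_pos u
  have hle := volume_localParallelSet_coneBody_two_le u
  set V := volume (localParallelSet (coneBody {u}) 1 (Prod.fst ⁻¹' coneFace {u}))
  have hfin : (n : ℝ≥0∞) * V ≠ ⊤ := by
    rw [h1]
    exact ENNReal.sum_ne_top.2 fun i _ => ENNReal.mul_ne_top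
      (ENNReal.mul_ne_top (by simp) (by simp)) (measure_ne_top _ _)
  have hn0 : (n : ℝ≥0∞) ≠ 0 := by
    simp only [ne_eq, Nat.cast_eq_zero]
    omega
  have h4 : 4 * ((n : ℝ≥0∞) * V) ≤ 2 * ((n : ℝ≥0∞) * V) := by
    calc 4 * ((n : ℝ≥0∞) * V)
        ≤ (n : ℝ≥0∞) * volume
            (localParallelSet (coneBody {u}) 2 (Prod.fst ⁻¹' coneFace {u})) := by
          rw [h1, h2, Finset.mul_sum]
          refine Finset.sum_le_sum fun i _ => ?_
          by_cases hi : (i : ℕ) = n - 1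
          · have : i = ⟨n - 1, hn⟩ := Fin.ext hi
            rw [this, h0]
            simp
          · have hpow : (4 : ℝ≥0∞) ≤ ENNReal.ofReal 2 ^ (n - (i : ℕ)) := by
              have h2i : 2 ≤ n - (i : ℕ) := by have := i.2; omega
              calc (4 : ℝ≥0∞) = 2 ^ 2 := by norm_num
                _ ≤ 2 ^ (n - (i : ℕ)) := pow_le_pow_right₀ one_le_two h2i
                _ = _ := by simp
            rw [ENNReal.ofReal_one, one_pow, mul_one, ← mul_assoc, mul_comm 4]
            gcongr
      _ ≤ (n : ℝ≥0∞) * (2 * V) := by gcongr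
      _ = 2 * ((n : ℝ≥0∞) * V) := by ring
  have hpos' : (n : ℝ≥0∞) * V ≠ 0 := mul_ne_zero hn0 hpos.ne'
  have := (ENNReal.mul_le_mul_iff_left hpos' hfin).1 h4
  norm_num at this

theorem ae_mem_normalCycle (K : ConvexBody (E n)) (i : Fin n) :
    ∀ᵐ p ∂supportMeasure K i, p ∈ normalCycle K :=
  supportMeasure_compl_normalCycle K i

/-- On the facet of the half ball with outer normal `u`, the curvature measure with density `f`
is `f u` times a positive constant. -/
theorem curvatureOfDensity_facet (hn : n - 1 < n) (f : C(Sph n, ℂ)) (u : Sph n) :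
    curvatureOfDensity hn f (coneBody {u}) (coneFace {u})
      = f u * ((supportMeasure (coneBody {u}) ⟨n - 1, hn⟩).real
          (Prod.fst ⁻¹' coneFace {u}) : ℂ) := by
  have hW := (isClosed_coneFace {u}).measurableSet
  rw [curvatureOfDensity_apply hn f _ hW]
  have hae : ∀ᵐ p ∂(supportMeasure (coneBody {u}) ⟨n - 1, hn⟩).restrict
      (Prod.fst ⁻¹' coneFace {u}), f p.2 = f u := by
    refine (ae_restrict_iff' (measurable_fst hW)).2 ?_
    filter_upwards [ae_mem_normalCycle (coneBody {u}) ⟨n - 1, hn⟩] with p hp hx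
    rw [eq_of_mem_normalCycle_coneBody hp hx]
  rw [integral_congr_ae hae, setIntegral_const, Complex.real_smul, mul_comm]

theorem facetMass_ne_zero (hn : n - 1 < n) (u : Sph n) :
    ((supportMeasure (coneBody {u}) ⟨n - 1, hn⟩).real (Prod.fst ⁻¹' coneFace {u}) : ℂ) ≠ 0 := by
  rw [Complex.ofReal_ne_zero, measureReal_ne_zero_iff]
  exact supportMeasure_facet_ne_zero hn u

end HalfBall

/-! ### The density of a curvature measure -/

section DensityOf

variable {n : ℕ} [Nonempty (Sph n)]

/-- The density of `Φ` at the unit vector `u`: the ratio of the masses which `Φ` and the support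
measure of order `n - 1` give to the facet of the half ball with outer normal `u`. -/
noncomputable def density (hn : n - 1 < n) (Φ : ConvexBody (E n) → ComplexMeasure (E n))
    (u : Sph n) : ℂ :=
  Φ (coneBody {u}) (coneFace {u}) /
    ((supportMeasure (coneBody {u}) ⟨n - 1, hn⟩).real (Prod.fst ⁻¹' coneFace {u}) : ℂ)

/-- The tent function `max 0 (3/2 - ‖x‖)`. -/
noncomputable def tent (n : ℕ) : E n →ᵇ ℝ :=
  BoundedContinuousFunction.ofNormedAddCommGroup (fun x => max 0 (3 / 2 - ‖x‖)) (by fun_prop)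
    (3 / 2) fun x => by
      rw [Real.norm_of_nonneg (le_max_left _ _)]
      exact max_le (by norm_num) (by linarith [norm_nonneg x])

omit [Nonempty (Sph n)] in
theorem tent_apply (x : E n) : tent n x = max 0 (3 / 2 - ‖x‖) := rfl

variable {Φ : ConvexBody (E n) → ComplexMeasure (E n)}

/-- Inside the ball of radius `2`, the measure `Φ` of the half ball with normal `u` is
`density u` times the support measure. -/
theorem integral_tent_eq (hn : n - 1 < n) (hΦ : Φ ∈ Curv n ((n : ℝ) - 1)) (u : Sph n) :
    ∫ᵛ x, tent n x ∂•(Φ (coneBody {u})) = density hn Φ u *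
      ((∫ p, tent n p.1 ∂supportMeasure (coneBody {u}) ⟨n - 1, hn⟩ : ℝ) : ℂ) := by
  set f : C(Sph n, ℂ) := ContinuousMap.const _ (density hn Φ u)
  have hΔ := sub_mem_curv hΦ (curvatureOfDensity_mem_curv hn f)
  have hface : Φ (coneBody {u}) (coneFace {u})
      - curvatureOfDensity hn f (coneBody {u}) (coneFace {u}) = 0 := by
    rw [curvatureOfDensity_facet, ContinuousMap.const_apply, density,
      div_mul_cancel₀ _ (facetMass_ne_zero hn u), sub_self]
  have hvar := curv_variation_eq_zero_of_polyhedral (K := coneBody {u}) (V := Metric.ball 0 2)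
    (ι := Unit) (v := fun _ => u) (h := fun _ => 0) (z := -u) hn hΔ Metric.isOpen_ball (by
      ext x
      refine and_congr_left fun hx => ?_
      rw [SetLike.mem_coe, mem_coneBody]
      have := (mem_ball_zero_iff.1 hx).le
      simp [this])
    (fun _ => by
      rw [inner_neg_right, real_inner_self_eq_norm_sq, norm_coe_sph]
      norm_num) fun _ => hface
  have hint : ∀ μ : ComplexMeasure (E n), μ.Integrable (tent n) := fun μ =>
    Integrable.of_bound (tent n).continuous.aestronglyMeasurable ‖tent n‖
      (Eventually.of_forall (tent n).norm_coe_le_norm)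
  have hzero : ∫ᵛ x, tent n x
      ∂•(Φ (coneBody {u}) - curvatureOfDensity hn f (coneBody {u})) = 0 := by
    refine VectorMeasure.integral_eq_zero_of_ae ?_
    refine measure_mono_null (fun x hx => ?_) hvar
    by_contra hx2
    refine hx ?_
    rw [mem_ball_zero_iff, not_lt] at hx2
    change tent n x = 0
    rw [tent_apply]
    exact max_eq_left (by linarith)
  rw [VectorMeasure.integral_sub_vectorMeasure (hint _) (hint _), sub_eq_zero] at hzero
  rw [hzero, integral_curvatureOfDensity]
  simp only [f, ContinuousMap.const_apply, Complex.real_smul]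
  rw [integral_mul_const, integral_complex_ofReal, mul_comm]

theorem integral_tent_ne_zero (hn : n - 1 < n) (u : Sph n) :
    ((∫ p, tent n p.1 ∂supportMeasure (coneBody {u}) ⟨n - 1, hn⟩ : ℝ) : ℂ) ≠ 0 := by
  rw [Complex.ofReal_ne_zero]
  refine ((integral_pos_iff_support_of_nonneg
    (f := fun p : E n × Sph n => tent n p.1) (fun p => le_max_left _ _) ?_).2 ?_).ne'
  · exact Integrable.of_bound
      ((tent n).continuous.comp continuous_fst).aestronglyMeasurable ‖tent n‖
      (Eventually.of_forall fun p => (tent n).norm_coe_le_norm _)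
  · refine (pos_iff_ne_zero.2 (supportMeasure_facet_ne_zero hn u)).trans_le
      (measure_mono fun p hp => ?_)
    have := (mem_coneFace.1 hp).2
    rw [Function.mem_support, tent_apply, max_eq_right (by linarith)]
    linarith

/-- The facet varies with `u`, so the definition of the density does not show its continuity.
Tested against the tent function, the numerator and the denominator become weakly continuous. -/
theorem continuous_density (hn : n - 1 < n) (hΦ : Φ ∈ Curv n ((n : ℝ) - 1)) :
    Continuous (density hn Φ) := by
  have hnum : Continuous fun u : Sph n => ∫ᵛ x, tent n x ∂•(Φ (coneBody {u})) := by
    refine continuous_iff_seqContinuous.2 fun w u hw => ?_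
    exact hΦ.1.continuity _ _ ((continuous_coneBody_singleton.tendsto u).comp hw) (tent n)
  have hden : Continuous fun u : Sph n =>
      ((∫ p, tent n p.1 ∂supportMeasure (coneBody {u}) ⟨n - 1, hn⟩ : ℝ) : ℂ) := by
    refine continuous_iff_seqContinuous.2 fun w u hw => ?_
    have := (curvatureOfDensity_isCurvatureMeasure hn (1 : C(Sph n, ℂ))).continuity _ _
      ((continuous_coneBody_singleton.tendsto u).comp hw) (tent n)
    simp only [integral_curvatureOfDensity, ContinuousMap.one_apply, Complex.real_smul, mul_one,
      integral_complex_ofReal] at this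
    exact this
  have heq : density hn Φ = fun u => (∫ᵛ x, tent n x ∂•(Φ (coneBody {u}))) /
      ((∫ p, tent n p.1 ∂supportMeasure (coneBody {u}) ⟨n - 1, hn⟩ : ℝ) : ℂ) := by
    funext u
    rw [integral_tent_eq hn hΦ, mul_div_cancel_right₀ _ (integral_tent_ne_zero hn u)]
  rw [heq]
  exact hnum.div hden (integral_tent_ne_zero hn)

/-- The difference of the two sides is a curvature measure of degree `n - 1` that vanishes on the
facets of half balls. -/
theorem eq_curvatureOfDensity (hn : n - 1 < n) (hΦ : Φ ∈ Curv n ((n : ℝ) - 1))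
    (K : ConvexBody (E n)) :
    Φ K = curvatureOfDensity hn ⟨density hn Φ, continuous_density hn hΦ⟩ K := by
  refine sub_eq_zero.1 (curv_eq_zero_of_facet_eq_zero hn
    (sub_mem_curv hΦ (curvatureOfDensity_mem_curv hn ⟨_, continuous_density hn hΦ⟩)) (fun u => ?_) K)
  rw [sub_apply, curvatureOfDensity_facet, ContinuousMap.coe_mk, density,
    div_mul_cancel₀ _ (facetMass_ne_zero hn u), sub_self]

end DensityOf

end CurvatureMeasures

theorem mainTheorem6 (n : ℕ) (hn : 1 ≤ n)
    (Φ : ConvexBody (CurvatureMeasures.E n) → ComplexMeasure (CurvatureMeasures.E n))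
    (hΦ : Φ ∈ CurvatureMeasures.Curv n ((n : ℝ) - 1)) :
    ∃! f : C(CurvatureMeasures.Sph n, ℂ),
      ∀ (K : ConvexBody (CurvatureMeasures.E n)) (β : Set (CurvatureMeasures.E n)),
        MeasurableSet β →
        Φ K β = ∫ p in Prod.fst ⁻¹' β, f p.2
          ∂(CurvatureMeasures.supportMeasure K ⟨n - 1, Nat.sub_lt hn Nat.one_pos⟩) := by
  have hn' : n - 1 < n := Nat.sub_lt hn Nat.one_pos
  have hne : Nonempty (CurvatureMeasures.Sph n) :=
    ⟨⟨EuclideanSpace.single ⟨0, hn⟩ (1 : ℝ), by simp⟩⟩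
  refine ⟨⟨_, CurvatureMeasures.continuous_density hn' hΦ⟩, fun K β hβ => ?_, fun f hf => ?_⟩
  · rw [CurvatureMeasures.eq_curvatureOfDensity hn' hΦ K,
      CurvatureMeasures.curvatureOfDensity_apply hn' _ K hβ]
  · ext u
    have hW := (CurvatureMeasures.isClosed_coneFace {u}).measurableSet
    have h := hf (CurvatureMeasures.coneBody {u}) _ hW
    rw [← CurvatureMeasures.curvatureOfDensity_apply hn' f _ hW,
      CurvatureMeasures.curvatureOfDensity_facet] at h
    exact eq_div_of_mul_eq (CurvatureMeasures.facetMass_ne_zero hn' u) h.symm
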